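/- Let $\Lambda\neq 0$ be real, $I\subset\mathbb R$ open, and $\Omega\subset\mathbb C$ a simply connected open set on which $P=1+\tfrac12\Lambda\zeta\bar\zeta$ does not vanish. For a smooth real function $H(u,\zeta)$ on $I\times\Omega$ consider on $M=\{(u,v,\zeta): u\in I,\ v\in\mathbb R,\ \zeta\in\Omega\}$ the Lorentzian metric $$ds^2=\frac{2\,d\zeta\,d\bar\zeta}{P^2}-2\,du\,dv+(\Lambda v^2-H)\,du^2 ,$$ i.e. the Nariai ($\Lambda>0$) or anti-Nariai ($\Lambda<0$) metric plus $-H\,du^2$, with the natural null tetrad $k=\partial_v$, $l=\tfrac12(\Lambda v^2-H)\partial_v+\partial_u$, $m=P\,\partial_{\bar\zeta}$ (so $k\cdot l=-1$, $m\cdot\bar m=1$). Put $Q=P$. For a smooth complex function $\Phi_2$ on $M$ let $F_{ab}=\mathrm{Re}\,(4\Phi_2\,k_{[a}m_{b]})$ be the null Maxwell field with component $\Phi_2$. The Einstein–Maxwell system is $$R_{ab}-\tfrac12Rg_{ab}+\Lambda g_{ab}=T_{ab}=F_{ac}F_b{}^c-\tfrac14g_{ab}F_{cd}F^{cd},\qquad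 dF=0,\quad F^{ab}{}_{;b}=0 .$$ Below, "holomorphic profile" means a function of $(u,\zeta)$ that is smooth on $I\times\Omega$ and holomorphic in $\zeta$. Then: 1. For every smooth $H$ and $\Phi_2$, the Maxwell equations $dF=0$, $F^{ab}{}_{;b}=0$ hold on $M$ if and only if $\Phi_2=E_2\,P^3/Q^2$ for some holomorphic profile $E_2(u,\zeta)$. 2. Let $E_2$ be a holomorphic profile and $\Phi_2=E_2P^3/Q^2$. There is a holomorphic profile $A=\int E_2\,d\zeta$ (that is, $\partial_\zeta A=E_2$), and for every such $A$ and every smooth real $H$, the Einstein–Maxwell system holds on $M$ if and only if $$H=2\Big|\int E_2\,d\zeta\Big|^2+f(u,\zeta)+\bar f(u,\bar\zeta)$$ for some holomorphic profile $f$. 3. For every smooth $H$, the Weyl scalars in the natural null tetrad are $\Psi_0=\Psi_1=\Psi_3=0$, $\Psi_2=-\tfrac13\Lambda$, $\Psi_4=\tfrac12(PH)_{,\zeta\zeta}\,P^4/Q^3$, and the metric is of Petrov type $II$ at every point where $\Psi_4\neq0$. 4. The electromagnetic wave is necessarily accompanied by a gravitational wave: if the Einstein–Maxwell system holds on $M$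 with smooth $H$ and $\Phi_2$, and $\Phi_2$ does not vanish identically on the wave-front $u=u_0$ ($u_0\in I$), then the set of $\zeta\in\Omega$ such that for all $v\in\mathbb R$ one has $\Psi_4(u_0,v,\zeta)\neq0$ and the metric is of Petrov type $II$ at $(u_0,v,\zeta)$ is open and dense in $\Omega$. -/

import Mathlib

open scoped ContDiff

noncomputable section

namespace KundtWave

/-! ### Lorentzian geometry in a coordinate chart of dimension four -/

/-- Points of a four-dimensional coordinate chart. -/
abbrev Pt : Type := Fin 4 → ℝ

/-- The components `g_ab` of a metric in the chart. -/
abbrev MetricField : Type := Pt → Matrix (Fin 4) (Fin 4) ℝ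

/-- The components `F_ab` of a covariant tensor field of rank two in the chart. -/
abbrev TwoTensorField : Type := Pt → Matrix (Fin 4) (Fin 4) ℝ

/-- The partial derivative `∂_i f`. -/
def pd (i : Fin 4) (f : Pt → ℝ) (x : Pt) : ℝ := fderiv ℝ f x (Pi.single i 1)

/-- The Christoffel symbols `Γ^a_bc` of the Levi-Civita connection. -/
def christoffel (g : MetricField) (a b c : Fin 4) (x : Pt) : ℝ :=
  (1 / 2) * ∑ d, (g x)⁻¹ a d *
    (pd b (fun y => g y d c) x + pd c (fun y => g y d b) x - pd d (fun y => g y b c) x)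

/-- The Riemann tensor `R^a_bcd`. -/
def riemann (g : MetricField) (a b c d : Fin 4) (x : Pt) : ℝ :=
  pd c (christoffel g a b d) x - pd d (christoffel g a b c) x
    + ∑ e, (christoffel g a c e x * christoffel g e b d x
        - christoffel g a d e x * christoffel g e b c x)

/-- The Riemann tensor `R_abcd` with all indices lowered. -/
def riemannLow (g : MetricField) (a b c d : Fin 4) (x : Pt) : ℝ :=
  ∑ e, g x a e * riemann g e b c d x

/-- The Ricci tensor `R_bd = R^a_bad`. -/
def ricci (g : MetricField) (b d : Fin 4) (x : Pt) : ℝ := ∑ a, riemann g a b a d x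

/-- The scalar curvature `R = g^ab R_ab`. -/
def scalarCurvature (g : MetricField) (x : Pt) : ℝ :=
  ∑ a, ∑ b, (g x)⁻¹ a b * ricci g a b x

/-- The Weyl tensor `C_abcd` in dimension four. -/
def weyl (g : MetricField) (a b c d : Fin 4) (x : Pt) : ℝ :=
  riemannLow g a b c d x
    - (1 / 2) * (g x a c * ricci g b d x - g x a d * ricci g b c x
        - g x b c * ricci g a d x + g x b d * ricci g a c x)
    + scalarCurvature g x / 6 * (g x a c * g x b d - g x a d * g x b c)

/-! ### The Einstein-Maxwell system with cosmological constant -/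

/-- The contravariant components `F^ab = g^ac g^bd F_cd`. -/
def raised (g : MetricField) (F : TwoTensorField) (a b : Fin 4) (x : Pt) : ℝ :=
  ∑ c, ∑ d, (g x)⁻¹ a c * (g x)⁻¹ b d * F x c d

/-- The covariant divergence `F^ab_{;b}`. -/
def divergence (g : MetricField) (F : TwoTensorField) (a : Fin 4) (x : Pt) : ℝ :=
  ∑ b, (pd b (raised g F a b) x
    + ∑ c, (christoffel g a b c x * raised g F c b x + christoffel g b b c x * raised g F a c x))

/-- The energy-momentum tensor `T_ab = F_ac F_b^c - (1/4) g_ab F_cd F^cd` of a Maxwell field.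
In terms of the complex self-dual field `𝓕 = F + i *F` this is `(1/2) 𝓕_a^c 𝓕̄_bc`. -/
def maxwellStress (g : MetricField) (F : TwoTensorField) (a b : Fin 4) (x : Pt) : ℝ :=
  (∑ c, ∑ d, (g x)⁻¹ c d * F x a c * F x b d)
    - (1 / 4) * g x a b * ∑ c, ∑ d, F x c d * raised g F c d x

/-- The source-free Maxwell equations on a region `M`: `F` is a two-form with `dF = 0` and
`F^ab_{;b} = 0`. -/
structure IsMaxwellField (g : MetricField) (F : TwoTensorField) (M : Set Pt) : Prop where
  antisymm : ∀ x ∈ M, ∀ a b, F x a b = -F x b a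
  closed : ∀ x ∈ M, ∀ a b c,
    pd a (fun y => F y b c) x + pd b (fun y => F y c a) x + pd c (fun y => F y a b) x = 0
  divergence_free : ∀ x ∈ M, ∀ a, divergence g F a x = 0

/-- The Einstein-Maxwell system on a region `M`:
`R_ab - (1/2) R g_ab + Λ g_ab = T_ab` together with the source-free Maxwell equations. -/
structure IsEinsteinMaxwell (Λ : ℝ) (g : MetricField) (F : TwoTensorField) (M : Set Pt) :
    Prop where
  maxwell : IsMaxwellField g F M
  einstein : ∀ x ∈ M, ∀ a b,
    ricci g a b x - (1 / 2) * scalarCurvature g x * g x a b + Λ * g x a b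
      = maxwellStress g F a b x

/-! ### Null tetrads, Weyl scalars and the Petrov type -/

/-- A tetrad `(k, l, m, m̄)` at a point, with `k`, `l` real and `m` complex. -/
structure Tetrad where
  k : Fin 4 → ℝ
  l : Fin 4 → ℝ
  m : Fin 4 → ℂ

/-- The complex conjugate vector. -/
def conjVec (w : Fin 4 → ℂ) : Fin 4 → ℂ := fun i => (starRingEnd ℂ) (w i)

/-- A real vector, regarded as a complex one. -/
def toC (w : Fin 4 → ℝ) : Fin 4 → ℂ := fun i => (w i : ℂ)

/-- The complex bilinear extension of the metric. -/
def dotC (g : MetricField) (x : Pt) (p q : Fin 4 → ℂ) : ℂ :=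
  ∑ a, ∑ b, (g x a b : ℂ) * p a * q b

/-- The components `w_a = g_ab w^b`. -/
def lower (g : MetricField) (x : Pt) (w : Fin 4 → ℂ) (a : Fin 4) : ℂ :=
  ∑ b, (g x a b : ℂ) * w b

/-- `(k, l, m, m̄)` is a null tetrad at `x`: `k·l = -1`, `m·m̄ = 1`, and all other products
vanish. -/
structure IsNullTetrad (g : MetricField) (x : Pt) (T : Tetrad) : Prop where
  kk : dotC g x (toC T.k) (toC T.k) = 0
  ll : dotC g x (toC T.l) (toC T.l) = 0
  kl : dotC g x (toC T.k) (toC T.l) = -1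
  km : dotC g x (toC T.k) T.m = 0
  lm : dotC g x (toC T.l) T.m = 0
  mm : dotC g x T.m T.m = 0
  mmbar : dotC g x T.m (conjVec T.m) = 1

/-- `C_abcd p^a q^b r^c s^d`. -/
def weylC (g : MetricField) (x : Pt) (p q r s : Fin 4 → ℂ) : ℂ :=
  ∑ a, ∑ b, ∑ c, ∑ d, (weyl g a b c d x : ℂ) * p a * q b * r c * s d

def Psi0 (g : MetricField) (x : Pt) (T : Tetrad) : ℂ :=
  weylC g x (toC T.k) T.m (toC T.k) T.m

def Psi1 (g : MetricField) (x : Pt) (T : Tetrad) : ℂ :=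
  weylC g x (toC T.k) (toC T.l) (toC T.k) T.m

def Psi2 (g : MetricField) (x : Pt) (T : Tetrad) : ℂ :=
  weylC g x (toC T.k) T.m (conjVec T.m) (toC T.l)

def Psi3 (g : MetricField) (x : Pt) (T : Tetrad) : ℂ :=
  weylC g x (toC T.k) (toC T.l) (conjVec T.m) (toC T.l)

def Psi4 (g : MetricField) (x : Pt) (T : Tetrad) : ℂ :=
  weylC g x (conjVec T.m) (toC T.l) (conjVec T.m) (toC T.l)

/-- The binary quartic whose roots are the principal null directions. -/
def weylQuartic (g : MetricField) (x : Pt) (T : Tetrad) (a b : ℂ) : ℂ :=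
  Psi0 g x T * a ^ 4 + 4 * Psi1 g x T * a ^ 3 * b + 6 * Psi2 g x T * a ^ 2 * b ^ 2
    + 4 * Psi3 g x T * a * b ^ 3 + Psi4 g x T * b ^ 4

/-- The metric is of Petrov type `II` at `x`: there are one double and two simple principal null
directions, i.e. the quartic has exactly one double root and two simple roots on the
projective line. (The root multiplicities do not depend on the null tetrad.) -/
def IsPetrovTypeII (g : MetricField) (x : Pt) : Prop :=
  ∃ T : Tetrad, IsNullTetrad g x T ∧
    ∃ p₁ p₂ q₁ q₂ r₁ r₂ : ℂ,
      p₁ * q₂ ≠ p₂ * q₁ ∧ p₁ * r₂ ≠ p₂ * r₁ ∧ q₁ * r₂ ≠ q₂ * r₁ ∧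
      ∀ a b : ℂ, weylQuartic g x T a b
        = (p₁ * a + p₂ * b) ^ 2 * (q₁ * a + q₂ * b) * (r₁ * a + r₂ * b)

/-- The null two-form `F_ab = Re (4 Φ₂ k_[a m_b])`, the real part of the self-dual null field
with the only non-vanishing tetrad component `Φ₂ = F_ab m̄^a l^b`. -/
def nullField (g : MetricField) (T : Pt → Tetrad) (Φ₂ : Pt → ℂ) : TwoTensorField := fun x =>
  Matrix.of fun a b =>
    (2 * Φ₂ x * (lower g x (toC (T x).k) a * lower g x (T x).m b
      - lower g x (T x).m a * lower g x (toC (T x).k) b)).re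

/-! ### Waves in the (anti-)Nariai universe -/

/-- The function `P = 1 + (Λ/2) ζ ζ̄`. -/
def nariaiP (Λ : ℝ) (ζ : ℂ) : ℝ := 1 + Λ / 2 * Complex.normSq ζ

/-- The function `Q`, which coincides with `P` for the (anti-)Nariai universe. -/
def nariaiQ (Λ : ℝ) (ζ : ℂ) : ℝ := 1 + Λ / 2 * Complex.normSq ζ

/-- The null coordinate `u`; the second coordinate `x 1` is `v`. -/
def uCoord (x : Pt) : ℝ := x 0

/-- The complex spatial coordinate `ζ`. -/
def zCoord (x : Pt) : ℂ := ⟨x 2, x 3⟩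

/-- The point with coordinates `(u, v, ζ)`. -/
def pt (u v : ℝ) (ζ : ℂ) : Pt := ![u, v, ζ.re, ζ.im]

/-- The spacetime region `u ∈ I`, `v ∈ ℝ`, `ζ ∈ Ω`. -/
def region (I : Set ℝ) (Ω : Set ℂ) : Set Pt := {x | uCoord x ∈ I ∧ zCoord x ∈ Ω}

/-- The metric `2 P⁻² dζ dζ̄ - 2 du dv + (Λ v² - H) du²` in the real coordinates `(u, v, x, y)`,
`ζ = x + i y`, that is, the (anti-)Nariai metric plus `-H du²`. -/
def nariaiWave (Λ : ℝ) (H : ℝ → ℂ → ℝ) : MetricField := fun x =>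
  !![Λ * x 1 ^ 2 - H (uCoord x) (zCoord x), -1, 0, 0;
     -1, 0, 0, 0;
     0, 0, 2 / nariaiP Λ (zCoord x) ^ 2, 0;
     0, 0, 0, 2 / nariaiP Λ (zCoord x) ^ 2]

/-- The natural null tetrad `k = ∂_v`, `l = (1/2)(Λ v² - H) ∂_v + ∂_u`, `m = P ∂_ζ̄`. -/
def naturalTetrad (Λ : ℝ) (H : ℝ → ℂ → ℝ) (x : Pt) : Tetrad where
  k := ![0, 1, 0, 0]
  l := ![1, (Λ * x 1 ^ 2 - H (uCoord x) (zCoord x)) / 2, 0, 0]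
  m := ![0, 0, nariaiP Λ (zCoord x) / 2, Complex.I * nariaiP Λ (zCoord x) / 2]

/-- The null Maxwell field with component `Φ₂` in the natural tetrad. -/
def nariaiNullField (Λ : ℝ) (H : ℝ → ℂ → ℝ) (Φ₂ : Pt → ℂ) : TwoTensorField :=
  nullField (nariaiWave Λ H) (naturalTetrad Λ H) Φ₂

/-- The field component `Φ₂ = E₂(u, ζ) P³ / Q²`. -/
def nullComponent (Λ : ℝ) (E₂ : ℝ → ℂ → ℂ) (x : Pt) : ℂ :=
  E₂ (uCoord x) (zCoord x) * (nariaiP Λ (zCoord x) : ℂ) ^ 3 / (nariaiQ Λ (zCoord x) : ℂ) ^ 2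

/-- A real function of `(u, ζ)`, smooth jointly in its arguments. -/
def IsSmoothProfile (I : Set ℝ) (Ω : Set ℂ) (H : ℝ → ℂ → ℝ) : Prop :=
  ContDiffOn ℝ ∞ (fun p : ℝ × ℂ => H p.1 p.2) (I ×ˢ Ω)

/-- A complex function of `(u, ζ)`, smooth jointly in its arguments and holomorphic in `ζ`. -/
def IsHolomorphicProfile (I : Set ℝ) (Ω : Set ℂ) (f : ℝ → ℂ → ℂ) : Prop :=
  ContDiffOn ℝ ∞ (fun p : ℝ × ℂ => f p.1 p.2) (I ×ˢ Ω) ∧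
    ∀ u ∈ I, DifferentiableOn ℂ (f u) Ω

/-- `A = ∫ E₂ dζ`. -/
def IsZetaPrimitive (I : Set ℝ) (Ω : Set ℂ) (E₂ A : ℝ → ℂ → ℂ) : Prop :=
  IsHolomorphicProfile I Ω A ∧ ∀ u ∈ I, ∀ ζ ∈ Ω, HasDerivAt (A u) (E₂ u ζ) ζ

/-- The Wirtinger derivative `∂_ζ`. -/
def dzeta (φ : ℂ → ℂ) (ζ : ℂ) : ℂ :=
  (1 / 2) * (fderiv ℝ φ ζ 1 - Complex.I * fderiv ℝ φ ζ Complex.I)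

end KundtWave

end

/-! Everything rests on one explicit curvature computation. The background is a product of two
surfaces of Gauss curvature Λ, and the function H multiplies the square of the null form du. Hence
the Ricci tensor is Λg plus (P²/4)(H_xx + H_yy) du², the scalar curvature is 4Λ, and the stress
tensor of the null field is 2P²|Φ₂/P|² du². Einstein's equations reduce to ∂_ζ∂_ζ̄ H = 2|Φ₂/P|²
(`ricci_nariaiWave`, `einstein_iff`). The Maxwell equations say that Φ₂/P is independent of v and
satisfies the Cauchy-Riemann equations (`isMaxwellField_iff`). As Q = P, this quotient is E₂.

To solve for H, note that H_ζ - 2 E₂ Ā is holomorphic when ∂_ζ∂_ζ̄ H = 2|E₂|². If g is a primitive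
of it, the real function H - (2|A|² + g + ḡ) depends on u only and can be absorbed into g
(`laplacian_profile_iff`). The primitives must be smooth in u as well. They are integrals along
segments in discs, which differ on overlaps by functions of u alone. They are glued by lifting the
identity of the simply connected Ω through a covering whose fibre is a group of functions of u
(`exists_global_section`, `exists_isZetaPrimitive`).

The Weyl components give Ψ₄ = ½ P (PH)_ζζ with Ψ₂ = -Λ/3 and all others zero, so the quartic
b²(-2Λa² + Ψ₄b²) has type II wherever Ψ₄ ≠ 0.

For the last claim, suppose (PH)_ζζ = 0 on an open piece of a wave-front. Eliminating Ā and f from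
this equation and its derivatives leaves Ē₂ · (P³E₂)_ζζ / P = 0 (`deriv_eq_zero_of_generating`).
Where E₂ ≠ 0 the second factor is a quadratic polynomial in ζ̄ with holomorphic coefficients. These
must all vanish, and then Λ ≠ 0 forces E₂ = 0, a contradiction. By the identity theorem E₂ would
vanish on the whole front. -/

noncomputable section

namespace KundtWave

/-! ### Wirtinger calculus -/

/-- `φ` is real-differentiable at `z` with Wirtinger derivatives `∂_ζ φ = a`, `∂_ζ̄ φ = b`. -/
def HasWirtinger (φ : ℂ → ℂ) (a b z : ℂ) : Prop :=
  HasFDerivAt φ (a • (1 : ℂ →L[ℝ] ℂ) + b • (Complex.conjCLE : ℂ →L[ℝ] ℂ)) z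

namespace HasWirtinger

variable {φ ψ : ℂ → ℂ} {a b a' b' z : ℂ}

theorem dzeta_eq (h : HasWirtinger φ a b z) : dzeta φ z = a := by
  have := h.fderiv
  simp only [dzeta, this]
  simp
  linear_combination (-(a - b) / 2) * Complex.I_sq

/-- A real-linear endomorphism of ℂ splits uniquely into a complex-linear and an antilinear part,
whose coefficients are read off from its values at 1 and i. -/
theorem of_fderiv {L : ℂ →L[ℝ] ℂ} (h : HasFDerivAt φ L z) :
    HasWirtinger φ ((1 / 2) * (L 1 - Complex.I * L Complex.I))
      ((1 / 2) * (L 1 + Complex.I * L Complex.I)) z := by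
  refine HasFDerivAt.congr_fderiv h ?_
  ext w
  have hw : L w = w.re * L 1 + w.im * L Complex.I := by
    conv_lhs => rw [show w = w.re • (1 : ℂ) + w.im • Complex.I by simp]
    rw [map_add, map_smul, map_smul]; simp
  have hz : w = w.re + w.im * Complex.I := (Complex.re_add_im w).symm
  have hc : (starRingEnd ℂ) w = w.re - w.im * Complex.I := by
    apply Complex.ext <;> simp
  rw [hw]
  simp only [add_apply, smul_apply, one_apply_eq_self, smul_eq_mul,
    ContinuousLinearEquiv.coe_coe, Complex.conjCLE_apply, hc]
  linear_combination (-(1 / 2) * (L 1 - Complex.I * L Complex.I)) * hz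
    + (w.im : ℂ) * L Complex.I * Complex.I_sq

/-- This is the device by which identities are extracted below: one function is differentiated in
two ways and the coefficients are compared. -/
theorem unique (h : HasWirtinger φ a b z) (h' : HasWirtinger φ a' b' z) : a = a' ∧ b = b' := by
  have e := HasFDerivAt.unique h h'
  have e1 := congrArg (fun L : ℂ →L[ℝ] ℂ => L 1) e
  have e2 := congrArg (fun L : ℂ →L[ℝ] ℂ => L Complex.I) e
  simp at e1 e2
  have e3 : a - b = a' - b' := mul_right_cancel₀ Complex.I_ne_zero (by linear_combination e2)
  constructor
  · linear_combination (e1 + e3) / 2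
  · linear_combination (e1 - e3) / 2

theorem congr (h : HasWirtinger φ a b z) (e : ψ =ᶠ[nhds z] φ) : HasWirtinger ψ a b z :=
  HasFDerivAt.congr_of_eventuallyEq h e

theorem eq_zero (h : HasWirtinger φ a b z) (e : ∀ᶠ w in nhds z, φ w = 0) : a = 0 ∧ b = 0 := by
  refine h.unique (HasWirtinger.congr (φ := fun _ => 0) ?_ e)
  have : HasFDerivAt (fun _ : ℂ => (0 : ℂ)) (0 : ℂ →L[ℝ] ℂ) z := hasFDerivAt_const _ _
  exact this.congr_fderiv (by ext; simp)

theorem const (c z : ℂ) : HasWirtinger (fun _ => c) 0 0 z := by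
  have : HasFDerivAt (fun _ : ℂ => c) (0 : ℂ →L[ℝ] ℂ) z := hasFDerivAt_const _ _
  exact this.congr_fderiv (by ext; simp)

theorem of_hasDerivAt (h : HasDerivAt φ a z) : HasWirtinger φ a 0 z := by
  have := h.hasFDerivAt.restrictScalars ℝ
  refine HasFDerivAt.congr_fderiv this ?_
  ext w
  simp [mul_comm]

/-- With no antilinear part, the real derivative is already complex-linear; this is the
Cauchy-Riemann criterion. -/
theorem hasDerivAt (h : HasWirtinger φ a 0 z) : HasDerivAt φ a z := by
  rw [hasDerivAt_iff_hasFDerivAt]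
  refine hasFDerivAt_of_restrictScalars ℝ h ?_
  ext w
  simp [mul_comm]

theorem conj (h : HasWirtinger φ a b z) :
    HasWirtinger (fun w => (starRingEnd ℂ) (φ w)) ((starRingEnd ℂ) b) ((starRingEnd ℂ) a) z := by
  have := (Complex.conjCLE : ℂ →L[ℝ] ℂ).hasFDerivAt.comp z h
  refine HasFDerivAt.congr_fderiv this ?_
  ext w
  simp [add_comm]

theorem add (h : HasWirtinger φ a b z) (h' : HasWirtinger ψ a' b' z) :
    HasWirtinger (fun w => φ w + ψ w) (a + a') (b + b') z := by
  have := HasFDerivAt.add h h'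
  refine HasFDerivAt.congr_fderiv this ?_
  ext w
  simp
  ring

theorem mul (h : HasWirtinger φ a b z) (h' : HasWirtinger ψ a' b' z) :
    HasWirtinger (fun w => φ w * ψ w) (a * ψ z + φ z * a') (b * ψ z + φ z * b') z := by
  have := HasFDerivAt.mul h h'
  refine HasFDerivAt.congr_fderiv this ?_
  ext w
  simp
  ring

theorem const_mul (c : ℂ) (h : HasWirtinger φ a b z) :
    HasWirtinger (fun w => c * φ w) (c * a) (c * b) z := by
  simpa using (const c z).mul h

theorem sub (h : HasWirtinger φ a b z) (h' : HasWirtinger ψ a' b' z) :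
    HasWirtinger (fun w => φ w - ψ w) (a - a') (b - b') z := by
  simpa [sub_eq_add_neg] using h.add (h'.const_mul (-1))

theorem id (z : ℂ) : HasWirtinger (fun w => w) 1 0 z := of_hasDerivAt (hasDerivAt_id z)

theorem congr_deriv (h : HasWirtinger φ a b z) (ha : a = a') (hb : b = b') :
    HasWirtinger φ a' b' z := ha ▸ hb ▸ h

end HasWirtinger

/-! ### Gluing local sections over a simply connected space -/

section Gluing

variable {X : Type*} [TopologicalSpace X] {V : Type*} [AddCommGroup V] [TopologicalSpace V]
  [DiscreteTopology V]

/-- The bundle with discrete fibre `V` whose transition functions are differences of the given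
local sections. -/
def differenceCore (U : X → Set X) (hU : ∀ x, IsOpen (U x)) (hx : ∀ x, x ∈ U x) (g : X → X → V)
    (hg : ∀ i j, ContinuousOn (fun x => g i x - g j x) (U i ∩ U j)) : FiberBundleCore X X V where
  baseSet := U
  isOpen_baseSet := hU
  indexAt := fun x => x
  mem_baseSet_at := hx
  coordChange i j x v := v + (g i x - g j x)
  coordChange_self i x _ v := by simp
  continuousOn_coordChange i j := by
    have h1 : ContinuousOn (fun p : X × V => g i p.1 - g j p.1) ((U i ∩ U j) ×ˢ Set.univ) :=
      (hg i j).comp continuousOn_fst fun p hp => hp.1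
    have h2 : Continuous fun q : V × V => q.1 + q.2 := continuous_of_discreteTopology
    exact h2.comp_continuousOn (continuousOn_snd.prodMk h1)
  coordChange_comp i j k x _ v := by abel

/-- Local sections with locally constant differences glue, up to locally constant corrections,
over a simply connected space. -/
theorem exists_global_section [SimplyConnectedSpace X] [LocallyPathConnectedSpace X]
    {V : Type*} [AddCommGroup V]
    (U : X → Set X) (hU : ∀ x, IsOpen (U x)) (hx : ∀ x, x ∈ U x) (g : X → X → V)
    (hg : ∀ i j, ∀ x ∈ U i ∩ U j, ∀ᶠ y in nhds x, g i y - g j y = g i x - g j x) :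
    ∃ G : X → V, ∀ i, ∃ c : V, ∀ᶠ y in nhds i, G y = g i y + c := by
  classical
  -- The discrete topology makes the bundle projection a covering map.
  let _ : TopologicalSpace V := ⊥
  have : DiscreteTopology V := ⟨rfl⟩
  let Z := differenceCore U hU hx g fun i j x hx =>
    (continuousAt_const.congr ((hg i j x hx).mono fun y hy => hy.symm)).continuousWithinAt
  have cov : IsCoveringMap (Bundle.TotalSpace.proj : Bundle.TotalSpace V Z.Fiber → X) :=
    FiberBundle.isCoveringMap
  obtain ⟨x₀⟩ : Nonempty X := inferInstance
  -- Simple connectedness enters here: the identity map lifts to the covering, and the lift is a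
  -- global continuous section.
  obtain ⟨s, ⟨-, hs⟩, -⟩ := cov.existsUnique_continuousMap_lifts (ContinuousMap.id X) x₀
    (⟨x₀, (0 : V)⟩ : Bundle.TotalSpace V Z.Fiber) rfl
  have hs' : ∀ y, (s y).1 = y := fun y => congrFun hs y
  let σ : X → V := fun y => (s y).2
  refine ⟨fun y => σ y + g y y, fun i => ?_⟩
  have hc : ContinuousAt (fun y => ((Z.localTriv i) (s y)).2) i := by
    have h1 : ContinuousAt (Z.localTriv i) (s i) := by
      refine (Z.localTriv i).toOpenPartialHomeomorph.continuousAt ?_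
      show (s i).1 ∈ U i
      rw [hs']; exact hx i
    exact continuousAt_snd.comp (h1.comp s.continuous.continuousAt)
  -- The coordinate of the section in chart `i` is `G y - g i y`. It is continuous with discrete
  -- values, hence constant near `i`.
  have key : ∀ y, ((Z.localTriv i) (s y)).2 = σ y + (g y y - g i y) := by
    intro y
    show @HAdd.hAdd V V V _ (s y).2 (g (s y).1 (s y).1 - g i (s y).1) = _
    rw [hs']
  refine ⟨σ i, ?_⟩
  have := hc.eventually (IsOpen.mem_nhds (isOpen_discrete {((Z.localTriv i) (s i)).2}) rfl)
  filter_upwards [this] with y hy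
  have hy' : ((Z.localTriv i) (s y)).2 = ((Z.localTriv i) (s i)).2 := hy
  rw [key, key] at hy'
  have : σ y + g y y = g i y + (σ y + (g y y - g i y)) := by abel
  show σ y + g y y = _
  rw [this, hy']; abel

end Gluing

/-! ### Parametric integrals -/

/-- Clamping the parameter to [0,1] extends the integrand continuously to all real t without
changing the integral, so continuity becomes available on full neighbourhoods of the endpoints. -/
theorem continuousOn_comp_projIcc {H Y : Type*} [TopologicalSpace H] [TopologicalSpace Y]
    {f : H → ℝ → Y} {W : Set H}
    (hf : ContinuousOn (fun p : H × ℝ => f p.1 p.2) (W ×ˢ Set.Icc 0 1)) :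
    ContinuousOn (fun p : H × ℝ => f p.1 (Set.projIcc (0 : ℝ) 1 zero_le_one p.2))
      (W ×ˢ Set.univ) :=
  hf.comp (t := W ×ˢ Set.Icc 0 1)
    (f := fun p : H × ℝ => (p.1, (Set.projIcc (0 : ℝ) 1 zero_le_one p.2 : ℝ))) (by fun_prop)
    fun p hp => ⟨hp.1, Subtype.coe_prop _⟩

theorem continuousOn_slice {H Y : Type*} [TopologicalSpace H] [TopologicalSpace Y]
    {f : H → ℝ → Y} {W : Set H} {T : Set ℝ}
    (hf : ContinuousOn (fun p : H × ℝ => f p.1 p.2) (W ×ˢ T)) {h : H} (hh : h ∈ W) :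
    ContinuousOn (f h) T :=
  hf.comp (f := fun t : ℝ => (h, t)) (by fun_prop) fun t ht => ⟨hh, ht⟩

theorem continuousOn_parametric_integral {H G : Type*} [NormedAddCommGroup H]
    [NormedAddCommGroup G] [NormedSpace ℝ G] {F : H → ℝ → G} {W : Set H}
    (hF : ContinuousOn (fun p : H × ℝ => F p.1 p.2) (W ×ˢ Set.Icc 0 1)) :
    ContinuousOn (fun h => ∫ t in (0 : ℝ)..1, F h t) W := by
  have hF' := continuousOn_comp_projIcc hF
  rw [continuousOn_iff_continuous_domRestrict]
  have : Set.domRestrict W (fun h => ∫ t in (0 : ℝ)..1, F h t)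
      = fun h : W => ∫ t in (0 : ℝ)..1, F h (Set.projIcc (0 : ℝ) 1 zero_le_one t) := by
    ext h
    refine intervalIntegral.integral_congr fun t ht => ?_
    rw [Set.uIcc_of_le zero_le_one] at ht
    simp [Set.projIcc_of_mem _ ht]
  rw [this]
  refine intervalIntegral.continuous_parametric_intervalIntegral_of_continuous' ?_ 0 1
  exact hF'.comp_continuous (f := fun q : W × ℝ => ((q.1 : H), q.2)) (by fun_prop)
    (fun q => ⟨q.1.2, trivial⟩)

/-- Differentiation under the integral sign by domination. The derivative at h₀ is bounded on the
compact interval by some C; by compactness of [0,1] alone the bound C + 1 persists on a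
neighbourhood of h₀, so H need not be locally compact. -/
theorem hasFDerivAt_parametric_integral {H G : Type*} [NormedAddCommGroup H] [NormedSpace ℝ H]
    [NormedAddCommGroup G] [NormedSpace ℝ G] {F : H → ℝ → G} {F' : H → ℝ → H →L[ℝ] G}
    {W : Set H} (hW : IsOpen W)
    (hF : ContinuousOn (fun p : H × ℝ => F p.1 p.2) (W ×ˢ Set.Icc 0 1))
    (hF' : ContinuousOn (fun p : H × ℝ => F' p.1 p.2) (W ×ˢ Set.Icc 0 1))
    (hd : ∀ h ∈ W, ∀ t ∈ Set.Icc (0 : ℝ) 1, HasFDerivAt (fun h => F h t) (F' h t) h)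
    {h₀ : H} (h₀W : h₀ ∈ W) :
    HasFDerivAt (fun h => ∫ t in (0 : ℝ)..1, F h t) (∫ t in (0 : ℝ)..1, F' h₀ t) h₀ := by
  obtain ⟨C, s, hs, hsW, hC⟩ : ∃ C : ℝ, ∃ s ∈ nhds h₀, s ⊆ W ∧
      ∀ t ∈ Set.Icc (0 : ℝ) 1, ∀ h ∈ s, ‖F' h t‖ ≤ C := by
    have hK : IsCompact (Set.Icc (0 : ℝ) 1) := isCompact_Icc
    obtain ⟨C, hC⟩ := hK.exists_bound_of_continuousOn (continuousOn_slice hF' h₀W)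
    have hp := continuousOn_comp_projIcc hF'
    have h1 := hK.eventually_forall_of_forall_eventually (x₀ := h₀)
      (P := fun h t => ‖F' h (Set.projIcc (0 : ℝ) 1 zero_le_one t)‖ < C + 1) (fun t ht => by
        have hc := (hp.continuousAt ((hW.prod isOpen_univ).mem_nhds
          (⟨h₀W, trivial⟩ : (h₀, t) ∈ W ×ˢ Set.univ))).norm
        refine hc.eventually (gt_mem_nhds ?_)
        have := hC t ht
        simp only [Set.projIcc_of_mem _ ht]
        linarith)
    refine ⟨C + 1, _, Filter.inter_mem h1 (hW.mem_nhds h₀W), Set.inter_subset_right, ?_⟩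
    intro t ht h hh
    have := hh.1 t ht
    simp only [Set.projIcc_of_mem _ ht] at this
    exact this.le
  refine intervalIntegral.hasFDerivAt_integral_of_dominated_of_fderiv_le (𝕜 := ℝ) (μ := MeasureTheory.volume)
    (s := s) (bound := fun _ => C) hs ?_ ?_ ?_ ?_ ?_ ?_
  · filter_upwards [hW.mem_nhds h₀W] with h hh
    rw [Set.uIoc_of_le zero_le_one]
    exact ((continuousOn_slice hF hh).mono Set.Ioc_subset_Icc_self).aestronglyMeasurable measurableSet_Ioc
  · exact (continuousOn_slice hF h₀W).intervalIntegrable_of_Icc zero_le_one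
  · rw [Set.uIoc_of_le zero_le_one]
    exact ((continuousOn_slice hF' h₀W).mono Set.Ioc_subset_Icc_self).aestronglyMeasurable measurableSet_Ioc
  · refine Filter.Eventually.of_forall fun t ht h hh => hC t ?_ h hh
    rw [Set.uIoc_of_le zero_le_one] at ht
    exact Set.Ioc_subset_Icc_self ht
  · exact intervalIntegrable_const
  · refine Filter.Eventually.of_forall fun t ht h hh => hd h (hsW hh) t ?_
    rw [Set.uIoc_of_le zero_le_one] at ht
    exact Set.Ioc_subset_Icc_self ht

/-- Induction on the order. The target G is quantified inside the induction because the derivative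
takes values in `H →L[ℝ] G`, and the single universe keeps that space admissible. The open set O
around W × [0,1] lets the full derivative of F be used up to the endpoints. -/
theorem contDiffOn_parametric_integral_nat (n : ℕ) {H : Type} [NormedAddCommGroup H]
    [NormedSpace ℝ H] : ∀ {G : Type} [NormedAddCommGroup G] [NormedSpace ℝ G]
    {F : H × ℝ → G} {W : Set H} {O : Set (H × ℝ)}, IsOpen W → IsOpen O →
    W ×ˢ Set.Icc 0 1 ⊆ O → ContDiffOn ℝ n F O →
    ContDiffOn ℝ n (fun h => ∫ t in (0 : ℝ)..1, F (h, t)) W := by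
  induction n with
  | zero =>
    intro G _ _ F W O hW hO hsub hF
    simp only [Nat.cast_zero, contDiffOn_zero] at hF ⊢
    exact continuousOn_parametric_integral (F := fun h t => F (h, t)) (hF.mono hsub)
  | succ n ih =>
    intro G _ _ F W O hW hO hsub hF
    have hF1 : ContDiffOn ℝ n (fun p => (fderiv ℝ F p).comp (ContinuousLinearMap.inl ℝ H ℝ)) O := by
      have := hF.fderiv_of_isOpen (m := n) hO (by push_cast; exact le_rfl)
      exact this.clm_comp contDiffOn_const
    rw [Nat.cast_add, Nat.cast_one,
      contDiffOn_succ_iff_hasFDerivWithinAt_of_uniqueDiffOn hW.uniqueDiffOn]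
    refine ⟨fun h => absurd h (by simp), _, ih hW hO hsub hF1, fun h hh => ?_⟩
    refine (hasFDerivAt_parametric_integral (F := fun h t => F (h, t))
      (F' := fun h t => (fderiv ℝ F (h, t)).comp (ContinuousLinearMap.inl ℝ H ℝ)) hW
      (hF.continuousOn.mono hsub) (hF1.continuousOn.mono hsub) ?_ hh).hasFDerivWithinAt
    intro h hh t ht
    have hd : DifferentiableAt ℝ F (h, t) :=
      (hF.differentiableOn (by simp)).differentiableAt (hO.mem_nhds (hsub ⟨hh, ht⟩))
    exact hd.hasFDerivAt.comp h (hasFDerivAt_prodMk_left h t)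

theorem contDiffOn_parametric_integral {H G : Type} [NormedAddCommGroup H]
    [NormedSpace ℝ H] [NormedAddCommGroup G] [NormedSpace ℝ G]
    {F : H × ℝ → G} {W : Set H} {O : Set (H × ℝ)} (hW : IsOpen W) (hO : IsOpen O)
    (hsub : W ×ˢ Set.Icc 0 1 ⊆ O) (hF : ContDiffOn ℝ ∞ F O) :
    ContDiffOn ℝ ∞ (fun h => ∫ t in (0 : ℝ)..1, F (h, t)) W := by
  rw [contDiffOn_infty] at hF ⊢
  exact fun n => contDiffOn_parametric_integral_nat n hW hO hsub (hF n)

/-! ### Holomorphic primitives depending smoothly on a parameter -/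

/-- The primitive of `E u` along the segments issuing from `c`. -/
def segmentPrimitive (E : ℝ → ℂ → ℂ) (c : ℂ) (u : ℝ) (ζ : ℂ) : ℂ :=
  ∫ t in (0 : ℝ)..1, E u (c + t * (ζ - c)) * (ζ - c)

theorem add_mul_sub_mem_ball {c ζ : ℂ} {r t : ℝ} (hζ : ζ ∈ Metric.ball c r)
    (ht : t ∈ Set.Icc (0 : ℝ) 1) : c + t * (ζ - c) ∈ Metric.ball c r := by
  rw [mem_ball_iff_norm] at hζ ⊢
  have : ‖c + t * (ζ - c) - c‖ = t * ‖ζ - c‖ := by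
    rw [add_sub_cancel_left, norm_mul, Complex.norm_real, Real.norm_of_nonneg ht.1]
  rw [this]
  nlinarith [ht.1, ht.2, norm_nonneg (ζ - c)]

variable {I : Set ℝ} {Ω : Set ℂ} {E : ℝ → ℂ → ℂ}

theorem contDiffOn_segmentPrimitive (hI : IsOpen I) (hE : IsHolomorphicProfile I Ω E) {c : ℂ}
    {r : ℝ} (hr : Metric.ball c r ⊆ Ω) :
    ContDiffOn ℝ ∞ (fun p : ℝ × ℂ => segmentPrimitive E c p.1 p.2) (I ×ˢ Metric.ball c r) := by
  let m : (ℝ × ℂ) × ℝ → ℝ × ℂ := fun q => (q.1.1, c + q.2 * (q.1.2 - c))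
  have hof : ContDiff ℝ ∞ (fun t : ℝ => (t : ℂ)) := Complex.ofRealCLM.contDiff
  have hm : ContDiff ℝ ∞ m := by
    refine ContDiff.prodMk (by fun_prop) ?_
    exact contDiff_const.add ((hof.comp contDiff_snd).mul (by fun_prop))
  refine contDiffOn_parametric_integral
    (F := fun q : (ℝ × ℂ) × ℝ => E (m q).1 (m q).2 * (q.1.2 - c))
    (O := m ⁻¹' (I ×ˢ Metric.ball c r)) (hI.prod Metric.isOpen_ball)
    ((hI.prod Metric.isOpen_ball).preimage hm.continuous) ?_ ?_
  · rintro ⟨⟨u, ζ⟩, t⟩ ⟨⟨hu, hζ⟩, ht⟩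
    exact ⟨hu, add_mul_sub_mem_ball hζ ht⟩
  · refine ContDiffOn.mul ?_ (ContDiff.contDiffOn (by fun_prop))
    exact hE.1.comp hm.contDiffOn fun q hq => ⟨hq.1, hr hq.2⟩

/-- For fixed u some primitive exists on the disc, and the fundamental theorem of calculus along the
segment identifies it with the integral up to a constant. The integral formula is kept because it
also controls the dependence on u. -/
theorem hasDerivAt_segmentPrimitive (hE : IsHolomorphicProfile I Ω E) {c : ℂ}
    {r : ℝ} (hr : Metric.ball c r ⊆ Ω) {u : ℝ} (hu : u ∈ I) {ζ : ℂ} (hζ : ζ ∈ Metric.ball c r) :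
    HasDerivAt (segmentPrimitive E c u) (E u ζ) ζ := by
  have hEu : DifferentiableOn ℂ (E u) (Metric.ball c r) := (hE.2 u hu).mono hr
  obtain ⟨g, hg⟩ := hEu.isExactOn_ball
  have key : ∀ w ∈ Metric.ball c r, segmentPrimitive E c u w = g w - g c := by
    intro w hw
    have hd : ∀ t ∈ Set.uIcc (0 : ℝ) 1, HasDerivAt (fun t : ℝ => g (c + t * (w - c)))
        (E u (c + t * (w - c)) * (w - c)) t := by
      intro t ht
      rw [Set.uIcc_of_le zero_le_one] at ht
      have h1 : HasDerivAt (fun s : ℂ => c + s * (w - c)) (w - c) (t : ℂ) := by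
        simpa using ((hasDerivAt_id (t : ℂ)).mul_const (w - c)).const_add c
      exact ((hg _ (add_mul_sub_mem_ball hw ht)).comp (t : ℂ) h1).comp_ofReal
    have hc : ContinuousOn (fun t : ℝ => E u (c + t * (w - c)) * (w - c)) (Set.uIcc 0 1) := by
      refine ContinuousOn.mul ?_ continuousOn_const
      refine hEu.continuousOn.comp (by fun_prop) fun t ht => ?_
      rw [Set.uIcc_of_le zero_le_one] at ht
      exact add_mul_sub_mem_ball hw ht
    rw [segmentPrimitive, intervalIntegral.integral_eq_sub_of_hasDerivAt hd hc.intervalIntegrable]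
    simp
  have h := (hg ζ hζ).sub_const (g c)
  refine h.congr_of_eventuallyEq ?_
  filter_upwards [Metric.isOpen_ball.mem_nhds hζ] with w hw using key w hw

/-- The functions of `u` that are smooth on `I`. -/
def smoothFunctions (I : Set ℝ) : AddSubgroup (ℝ → ℂ) where
  carrier := {c | ContDiffOn ℝ ∞ c I}
  add_mem' := fun h h' => h.add h'
  zero_mem' := contDiffOn_const
  neg_mem' := fun h => h.neg

open Classical in
/-- A holomorphic profile on a simply connected domain has a primitive which is a holomorphic
profile. -/
theorem exists_isZetaPrimitive (hI : IsOpen I) (hΩ : IsOpen Ω) (hΩc : IsSimplyConnected Ω)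
    (hE : IsHolomorphicProfile I Ω E) : ∃ A : ℝ → ℂ → ℂ, IsZetaPrimitive I Ω E A := by
  have := hΩc.simplyConnectedSpace
  have := hΩ.locallyPathConnectedSpace
  have hr : ∀ x : Ω, ∃ r > 0, Metric.ball (x : ℂ) r ⊆ Ω := fun x => Metric.isOpen_iff.1 hΩ x x.2
  choose r hr0 hrΩ using hr
  -- The value 0 off I makes equality on I suffice for equality as functions on ℝ, so the
  -- differences of local primitives are locally constant as elements of `smoothFunctions I`.
  have hsm : ∀ x y : Ω, (y : ℂ) ∈ Metric.ball (x : ℂ) (r x) →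
      (fun u => if u ∈ I then segmentPrimitive E x u y else 0) ∈ smoothFunctions I := by
    intro x y hy
    show ContDiffOn ℝ ∞ _ I
    refine ContDiffOn.congr (f := fun u => segmentPrimitive E x u y) ?_ fun u hu => if_pos hu
    exact (contDiffOn_segmentPrimitive hI hE (hrΩ x)).comp
      (f := fun u : ℝ => (u, (y : ℂ))) (contDiff_id.prodMk contDiff_const).contDiffOn
      fun u hu => ⟨hu, hy⟩
  let g : Ω → Ω → smoothFunctions I := fun x y =>
    if hy : (y : ℂ) ∈ Metric.ball (x : ℂ) (r x) then ⟨_, hsm x y hy⟩ else 0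
  have hgv : ∀ x y : Ω, (y : ℂ) ∈ Metric.ball (x : ℂ) (r x) → ∀ u ∈ I,
      (g x y : ℝ → ℂ) u = segmentPrimitive E x u y := by
    intro x y hy u hu
    simp only [g, dif_pos hy, if_pos hu]
  have hgv' : ∀ x y : Ω, (y : ℂ) ∈ Metric.ball (x : ℂ) (r x) → ∀ u ∉ I,
      (g x y : ℝ → ℂ) u = 0 := by
    intro x y hy u hu
    simp only [g, dif_pos hy, if_neg hu]
  obtain ⟨G, hG⟩ := exists_global_section (fun x : Ω => {y : Ω | (y : ℂ) ∈ Metric.ball (x : ℂ) (r x)})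
    (fun x => Metric.isOpen_ball.preimage continuous_subtype_val)
    (fun x => Metric.mem_ball_self (hr0 x)) g (by
      rintro i j x ⟨hxi, hxj⟩
      obtain ⟨ε, hε, hsub⟩ := Metric.isOpen_iff.1
        ((Metric.isOpen_ball (x := (i : ℂ)) (ε := r i)).inter
          (Metric.isOpen_ball (x := (j : ℂ)) (ε := r j))) x ⟨hxi, hxj⟩
      have hnear : ∀ᶠ y : Ω in nhds x, (y : ℂ) ∈ Metric.ball (x : ℂ) ε :=
        continuous_subtype_val.continuousAt.eventually (Metric.ball_mem_nhds _ hε)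
      filter_upwards [hnear] with y hy
      ext u
      show (g i y : ℝ → ℂ) u - (g j y : ℝ → ℂ) u = (g i x : ℝ → ℂ) u - (g j x : ℝ → ℂ) u
      by_cases hu : u ∈ I
      · rw [hgv i y (hsub hy).1 u hu, hgv j y (hsub hy).2 u hu, hgv i x hxi u hu,
          hgv j x hxj u hu]
        -- Two local primitives have the same ζ-derivative, so on a small disc in the overlap their
        -- difference depends on u only.
        have hd : ∀ w ∈ Metric.ball (x : ℂ) ε, HasDerivAt
            (fun w => segmentPrimitive E i u w - segmentPrimitive E j u w) 0 w := by
          intro w hw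
          have := (hasDerivAt_segmentPrimitive hE (hrΩ i) hu (hsub hw).1).sub
            (hasDerivAt_segmentPrimitive hE (hrΩ j) hu (hsub hw).2)
          rwa [sub_self] at this
        exact Metric.isOpen_ball.is_const_of_deriv_eq_zero
          (convex_ball (x : ℂ) ε).isPreconnected
          (fun w hw => (hd w hw).differentiableAt.differentiableWithinAt)
          (fun w hw => (hd w hw).deriv) hy (Metric.mem_ball_self hε)
      · rw [hgv' i y (hsub hy).1 u hu, hgv' j y (hsub hy).2 u hu, hgv' i x hxi u hu,
          hgv' j x hxj u hu])
  let A : ℝ → ℂ → ℂ := fun u ζ => if h : ζ ∈ Ω then (G ⟨ζ, h⟩ : ℝ → ℂ) u else 0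
  -- The neighbourhood of ζ₀ is the same for all u, which is what joint smoothness requires.
  have hA : ∀ ζ₀ (h₀ : ζ₀ ∈ Ω), ∃ c : ℝ → ℂ, ContDiffOn ℝ ∞ c I ∧ ∀ᶠ ζ in nhds ζ₀, ∀ u ∈ I,
      A u ζ = segmentPrimitive E ζ₀ u ζ + c u := by
    intro ζ₀ h₀
    obtain ⟨c, hc⟩ := hG ⟨ζ₀, h₀⟩
    refine ⟨c, c.2, ?_⟩
    have h1 : ∀ᶠ ζ in nhds ζ₀, ∀ h : ζ ∈ Ω, G ⟨ζ, h⟩ = g ⟨ζ₀, h₀⟩ ⟨ζ, h⟩ + c := by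
      have h2 := hΩ.isOpenEmbedding_subtypeVal.map_nhds_eq ⟨ζ₀, h₀⟩
      have h3 : ∀ᶠ ζ in Filter.map Subtype.val (nhds (⟨ζ₀, h₀⟩ : Ω)), ∀ h : ζ ∈ Ω,
          G ⟨ζ, h⟩ = g ⟨ζ₀, h₀⟩ ⟨ζ, h⟩ + c := by
        rw [Filter.eventually_map]
        filter_upwards [hc] with y hy h using hy
      rwa [h2] at h3
    filter_upwards [h1, Metric.ball_mem_nhds ζ₀ (hr0 ⟨ζ₀, h₀⟩)] with ζ hζ hb u hu
    have hζΩ : ζ ∈ Ω := hrΩ ⟨ζ₀, h₀⟩ hb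
    simp only [A, dif_pos hζΩ, hζ hζΩ]
    rw [← hgv ⟨ζ₀, h₀⟩ ⟨ζ, hζΩ⟩ hb u hu]
    rfl
  have hder : ∀ u ∈ I, ∀ ζ ∈ Ω, HasDerivAt (A u) (E u ζ) ζ := by
    intro u hu ζ hζ
    obtain ⟨c, -, hc⟩ := hA ζ hζ
    refine ((hasDerivAt_segmentPrimitive hE (hrΩ ⟨ζ, hζ⟩) hu
      (Metric.mem_ball_self (hr0 ⟨ζ, hζ⟩))).add_const (c u)).congr_of_eventuallyEq ?_
    filter_upwards [hc] with w hw using hw u hu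
  refine ⟨A, ⟨?_, fun u hu ζ hζ => (hder u hu ζ hζ).differentiableAt.differentiableWithinAt⟩,
    hder⟩
  rintro ⟨u, ζ⟩ ⟨hu, hζ⟩
  obtain ⟨c, hcs, hc⟩ := hA ζ hζ
  have hS : I ×ˢ Metric.ball ζ (r ⟨ζ, hζ⟩) ∈ nhds (u, ζ) :=
    prod_mem_nhds (hI.mem_nhds hu) (Metric.ball_mem_nhds ζ (hr0 ⟨ζ, hζ⟩))
  have h1 := (contDiffOn_segmentPrimitive hI hE (hrΩ ⟨ζ, hζ⟩)).contDiffAt hS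
  have h2 : ContDiffAt ℝ ∞ (fun p : ℝ × ℂ => c p.1) (u, ζ) :=
    (hcs.contDiffAt (hI.mem_nhds hu)).comp (u, ζ) contDiffAt_fst
  refine ((h1.add h2).congr_of_eventuallyEq ?_).contDiffWithinAt
  have hc' := hc.prod_inr (nhds u)
  rw [← nhds_prod_eq] at hc'
  filter_upwards [hc', hS] with p hp hpS
  exact hp p.1 hpS.1

/-! ### Gradients in the chart -/

/-- `f` is differentiable at `x` with partial derivatives `∂_i f = g i`. -/
def HasGrad (f : Pt → ℝ) (g : Fin 4 → ℝ) (x : Pt) : Prop :=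
  HasFDerivAt f (∑ i, g i • (ContinuousLinearMap.proj i : Pt →L[ℝ] ℝ)) x

namespace HasGrad

variable {f f₁ f₂ : Pt → ℝ} {g g₁ g₂ : Fin 4 → ℝ} {x : Pt}

theorem pd_eq (h : HasGrad f g x) (i : Fin 4) : pd i f x = g i := by
  rw [pd, HasFDerivAt.fderiv h]
  simp [Pi.single_apply]

theorem of_differentiableAt (h : DifferentiableAt ℝ f x) : HasGrad f (fun i => pd i f x) x := by
  refine h.hasFDerivAt.congr_fderiv ?_
  ext w
  conv_lhs => rw [pi_eq_sum_univ' w]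
  simp only [map_sum, map_smul, pd]
  simp [mul_comm]

theorem congr_grad (h : HasGrad f g₁ x) (e : ∀ i, g₁ i = g₂ i) : HasGrad f g₂ x := by
  rwa [show g₂ = g₁ from funext fun i => (e i).symm]

theorem const (c : ℝ) : HasGrad (fun _ => c) 0 x := by
  refine (hasFDerivAt_const c x).congr_fderiv ?_
  ext w; simp

theorem coord (i : Fin 4) : HasGrad (fun y => y i) (Pi.single i 1) x := by
  refine (ContinuousLinearMap.proj i : Pt →L[ℝ] ℝ).hasFDerivAt.congr_fderiv ?_
  ext w; simp [Pi.single_apply]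

theorem add (h₁ : HasGrad f₁ g₁ x) (h₂ : HasGrad f₂ g₂ x) :
    HasGrad (fun y => f₁ y + f₂ y) (fun i => g₁ i + g₂ i) x := by
  refine (HasFDerivAt.add h₁ h₂).congr_fderiv ?_
  ext w; simp [add_mul, Finset.sum_add_distrib]

theorem mul (h₁ : HasGrad f₁ g₁ x) (h₂ : HasGrad f₂ g₂ x) :
    HasGrad (fun y => f₁ y * f₂ y) (fun i => g₁ i * f₂ x + f₁ x * g₂ i) x := by
  refine (HasFDerivAt.mul h₁ h₂).congr_fderiv ?_
  ext w
  simp [add_mul, Finset.sum_add_distrib, Finset.mul_sum]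
  rw [add_comm]
  congr 1 <;> refine Finset.sum_congr rfl fun i _ => by ring

theorem const_mul (c : ℝ) (h : HasGrad f g x) :
    HasGrad (fun y => c * f y) (fun i => c * g i) x :=
  ((const c).mul h).congr_grad fun i => by simp

theorem neg (h : HasGrad f g x) : HasGrad (fun y => -f y) (fun i => -g i) x := by
  simpa using h.const_mul (-1)

theorem sub (h₁ : HasGrad f₁ g₁ x) (h₂ : HasGrad f₂ g₂ x) :
    HasGrad (fun y => f₁ y - f₂ y) (fun i => g₁ i - g₂ i) x := by
  simpa [sub_eq_add_neg] using h₁.add h₂.neg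

theorem inv (h : HasGrad f g x) (h0 : f x ≠ 0) :
    HasGrad (fun y => (f y)⁻¹) (fun i => -g i / f x ^ 2) x := by
  refine ((hasDerivAt_inv h0).comp_hasFDerivAt x h).congr_fderiv ?_
  ext w
  simp [Finset.mul_sum]
  rw [← Finset.sum_neg_distrib]
  refine Finset.sum_congr rfl fun i _ => by ring

theorem div (h₁ : HasGrad f₁ g₁ x) (h₂ : HasGrad f₂ g₂ x) (h0 : f₂ x ≠ 0) :
    HasGrad (fun y => f₁ y / f₂ y) (fun i => (g₁ i * f₂ x - f₁ x * g₂ i) / f₂ x ^ 2) x := by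
  refine (h₁.mul (h₂.inv h0)).congr_grad fun i => ?_
  field_simp
  ring

theorem pow_two (h : HasGrad f g x) : HasGrad (fun y => f y ^ 2) (fun i => 2 * f x * g i) x := by
  have := h.mul h
  simp only [← _root_.pow_two] at this
  exact this.congr_grad fun i => by ring

end HasGrad

theorem pd_congr {f f₁ : Pt → ℝ} {x : Pt} (i : Fin 4) (e : f =ᶠ[nhds x] f₁) :
    pd i f x = pd i f₁ x := by
  rw [pd, pd, e.fderiv_eq]

theorem pd_comm {f : Pt → ℝ} {R : Set Pt} (hR : IsOpen R) (hf : ContDiffOn ℝ ∞ f R) {x : Pt}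
    (hx : x ∈ R) (i j : Fin 4) : pd i (pd j f) x = pd j (pd i f) x := by
  have hfx : ContDiffAt ℝ ∞ f x := hf.contDiffAt (hR.mem_nhds hx)
  have hd : DifferentiableAt ℝ (fderiv ℝ f) x :=
    (hfx.fderiv_right (m := 1) (by norm_cast)).differentiableAt (by simp)
  have hs : IsSymmSndFDerivAt ℝ f x := hfx.isSymmSndFDerivAt (by
    rw [minSmoothness_of_isRCLikeNormedField, ← one_add_one_eq_two]; norm_cast)
  have key : ∀ i j : Fin 4, pd i (pd j f) x
      = fderiv ℝ (fderiv ℝ f) x (Pi.single i 1) (Pi.single j 1) := by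
    intro i j
    have h1 : HasFDerivAt (fun y => fderiv ℝ f y (Pi.single j 1))
        ((fderiv ℝ (fderiv ℝ f) x).flip (Pi.single j 1)) x := by
      have := hd.hasFDerivAt.clm_apply (hasFDerivAt_const (Pi.single j (1 : ℝ) : Pt) x)
      simpa using this
    show fderiv ℝ (fun y => fderiv ℝ f y (Pi.single j 1)) x (Pi.single i 1) = _
    rw [h1.fderiv]; rfl
  rw [key, key]
  exact hs _ _

theorem contDiffOn_pd {f : Pt → ℝ} {R : Set Pt} (hR : IsOpen R) (hf : ContDiffOn ℝ ∞ f R)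
    (i : Fin 4) : ContDiffOn ℝ ∞ (pd i f) R :=
  (hf.fderiv_of_isOpen hR (by norm_cast)).clm_apply contDiffOn_const

theorem hasGrad_of_contDiffOn {f : Pt → ℝ} {R : Set Pt} (hR : IsOpen R) (hf : ContDiffOn ℝ ∞ f R)
    {x : Pt} (hx : x ∈ R) : HasGrad f (fun i => pd i f x) x :=
  .of_differentiableAt ((hf.contDiffAt (hR.mem_nhds hx)).differentiableAt (by simp))

/-! ### The wave profile and the conformal factor as functions on the chart -/

theorem contDiff_uCoord : ContDiff ℝ ∞ uCoord := contDiff_apply ℝ ℝ 0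

theorem zCoord_eq (x : Pt) : zCoord x = x 2 + x 3 * Complex.I := by
  apply Complex.ext <;> simp [zCoord]

theorem contDiff_zCoord : ContDiff ℝ ∞ zCoord := by
  have h : zCoord = fun x => (x 2 : ℂ) + x 3 * Complex.I := funext zCoord_eq
  have h2 : ContDiff ℝ ∞ fun x : Pt => (x 2 : ℂ) :=
    Complex.ofRealCLM.contDiff.comp (contDiff_apply ℝ ℝ (2 : Fin 4))
  have h3 : ContDiff ℝ ∞ fun x : Pt => (x 3 : ℂ) :=
    Complex.ofRealCLM.contDiff.comp (contDiff_apply ℝ ℝ (3 : Fin 4))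
  rw [h]
  exact h2.add (h3.mul contDiff_const)

theorem isOpen_region {I : Set ℝ} {Ω : Set ℂ} (hI : IsOpen I) (hΩ : IsOpen Ω) :
    IsOpen (region I Ω) :=
  (hI.preimage contDiff_uCoord.continuous).inter (hΩ.preimage contDiff_zCoord.continuous)

/-- The profile `H` as a function on the chart. -/
def chartH (H : ℝ → ℂ → ℝ) (x : Pt) : ℝ := H (uCoord x) (zCoord x)

/-- The function `P` on the chart. -/
def chartP (Λ : ℝ) (x : Pt) : ℝ := nariaiP Λ (zCoord x)

theorem contDiffOn_chartH {I : Set ℝ} {Ω : Set ℂ} {H : ℝ → ℂ → ℝ} (hH : IsSmoothProfile I Ω H) :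
    ContDiffOn ℝ ∞ (chartH H) (region I Ω) :=
  hH.comp (f := fun x : Pt => (uCoord x, zCoord x))
    (contDiff_uCoord.prodMk contDiff_zCoord).contDiffOn fun _ hx => ⟨hx.1, hx.2⟩

theorem chartP_eq (Λ : ℝ) (x : Pt) : chartP Λ x = 1 + Λ / 2 * (x 2 * x 2 + x 3 * x 3) := by
  simp [chartP, nariaiP, Complex.normSq_apply, zCoord]

theorem hasGrad_chartP (Λ : ℝ) (x : Pt) :
    HasGrad (chartP Λ) ![0, 0, Λ * x 2, Λ * x 3] x := by
  have h : chartP Λ = fun x => 1 + Λ / 2 * (x 2 * x 2 + x 3 * x 3) := funext (chartP_eq Λ)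
  rw [h]
  refine ((HasGrad.const 1).add ((((HasGrad.coord 2).mul (HasGrad.coord 2)).add
    ((HasGrad.coord 3).mul (HasGrad.coord 3))).const_mul (Λ / 2))).congr_grad fun i => ?_
  fin_cases i <;> simp <;> ring

theorem pd_one_chartH {H : ℝ → ℂ → ℝ} {x : Pt}
    (hd : DifferentiableAt ℝ (chartH H) x) : pd 1 (chartH H) x = 0 := by
  have hl : HasDerivAt (fun t : ℝ => x + t • (Pi.single 1 1 : Pt)) (Pi.single 1 1 : Pt) 0 := by
    simpa using ((hasDerivAt_id (0 : ℝ)).smul_const (Pi.single 1 1 : Pt)).const_add x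
  have hd' : HasFDerivAt (chartH H) (fderiv ℝ (chartH H) x)
      (x + (0 : ℝ) • (Pi.single 1 1 : Pt)) := by
    simpa using hd.hasFDerivAt
  have h1 := hd'.comp_hasDerivAt (0 : ℝ) hl
  have h2 : (chartH H ∘ fun t : ℝ => x + t • (Pi.single 1 1 : Pt)) = fun _ => chartH H x := by
    ext t
    simp [chartH, uCoord, zCoord]
  rw [h2] at h1
  exact h1.unique (hasDerivAt_const _ _)

/-! ### The Levi-Civita connection of the wave metric -/

theorem nariaiWave_eq (Λ : ℝ) (H : ℝ → ℂ → ℝ) (x : Pt) : nariaiWave Λ H x =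
    !![Λ * x 1 ^ 2 - chartH H x, -1, 0, 0;
     -1, 0, 0, 0;
     0, 0, 2 / chartP Λ x ^ 2, 0;
     0, 0, 0, 2 / chartP Λ x ^ 2] := rfl

theorem nariaiWave_inv (Λ : ℝ) (H : ℝ → ℂ → ℝ) (x : Pt) (hp : chartP Λ x ≠ 0) :
    (nariaiWave Λ H x)⁻¹ =
    !![0, -1, 0, 0;
     -1, -(Λ * x 1 ^ 2 - chartH H x), 0, 0;
     0, 0, chartP Λ x ^ 2 / 2, 0;
     0, 0, 0, chartP Λ x ^ 2 / 2] := by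
  refine Matrix.inv_eq_right_inv ?_
  rw [nariaiWave_eq]
  ext i j
  fin_cases i <;> fin_cases j <;> simp [Matrix.mul_apply, Fin.sum_univ_four, hp]

/-- The partial derivatives `∂_c g_ab` of the wave metric, as a function of `a`, `b`, `c`. -/
def metricGrad (Λ : ℝ) (H : ℝ → ℂ → ℝ) (x : Pt) : Matrix (Fin 4) (Fin 4) (Fin 4 → ℝ) :=
  !![![-pd 0 (chartH H) x, 2 * Λ * x 1, -pd 2 (chartH H) x, -pd 3 (chartH H) x], 0, 0, 0;
    0, 0, 0, 0;
    0, 0, ![0, 0, -(4 * Λ * x 2) / chartP Λ x ^ 3, -(4 * Λ * x 3) / chartP Λ x ^ 3], 0;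
    0, 0, 0, ![0, 0, -(4 * Λ * x 2) / chartP Λ x ^ 3, -(4 * Λ * x 3) / chartP Λ x ^ 3]]

theorem hasGrad_nariaiWave {Λ : ℝ} {H : ℝ → ℂ → ℝ} {x : Pt} (hp : chartP Λ x ≠ 0)
    (hd : DifferentiableAt ℝ (chartH H) x) (a b : Fin 4) :
    HasGrad (fun y => nariaiWave Λ H y a b) (metricGrad Λ H x a b) x := by
  have h1 := pd_one_chartH hd
  have hH : HasGrad (fun y => Λ * y 1 ^ 2 - chartH H y)
      ![-pd 0 (chartH H) x, 2 * Λ * x 1, -pd 2 (chartH H) x, -pd 3 (chartH H) x] x := by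
    refine (((HasGrad.coord 1).pow_two.const_mul Λ).sub (.of_differentiableAt hd)).congr_grad ?_
    intro i
    fin_cases i <;> simp [h1] <;> ring
  have hP : HasGrad (fun y => 2 / chartP Λ y ^ 2)
      ![0, 0, -(4 * Λ * x 2) / chartP Λ x ^ 3, -(4 * Λ * x 3) / chartP Λ x ^ 3] x := by
    refine ((HasGrad.const 2).div (hasGrad_chartP Λ x).pow_two (pow_ne_zero 2 hp)).congr_grad ?_
    intro i
    fin_cases i <;> simp <;> (field_simp; ring)
  fin_cases a <;> fin_cases b <;>
    first | exact hH | exact hP | exact HasGrad.const 0 | exact HasGrad.const (-1)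

/-- The Christoffel symbols `Γ^a_bc` of the wave metric. -/
def waveChristoffel (Λ : ℝ) (H : ℝ → ℂ → ℝ) (x : Pt) : Fin 4 → Matrix (Fin 4) (Fin 4) ℝ :=
  ![!![Λ * x 1, 0, 0, 0;
      0, 0, 0, 0;
      0, 0, 0, 0;
      0, 0, 0, 0],
    !![pd 0 (chartH H) x / 2 + Λ * x 1 * (Λ * x 1 ^ 2 - chartH H x), -(Λ * x 1),
        pd 2 (chartH H) x / 2, pd 3 (chartH H) x / 2;
      -(Λ * x 1), 0, 0, 0;
      pd 2 (chartH H) x / 2, 0, 0, 0;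
      pd 3 (chartH H) x / 2, 0, 0, 0],
    !![chartP Λ x ^ 2 * pd 2 (chartH H) x / 4, 0, 0, 0;
      0, 0, 0, 0;
      0, 0, -(Λ * x 2 / chartP Λ x), -(Λ * x 3 / chartP Λ x);
      0, 0, -(Λ * x 3 / chartP Λ x), Λ * x 2 / chartP Λ x],
    !![chartP Λ x ^ 2 * pd 3 (chartH H) x / 4, 0, 0, 0;
      0, 0, 0, 0;
      0, 0, Λ * x 3 / chartP Λ x, -(Λ * x 2 / chartP Λ x);
      0, 0, -(Λ * x 2 / chartP Λ x), -(Λ * x 3 / chartP Λ x)]]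

theorem christoffel_nariaiWave {Λ : ℝ} {H : ℝ → ℂ → ℝ} {x : Pt} (hp : chartP Λ x ≠ 0)
    (hd : DifferentiableAt ℝ (chartH H) x) (a b c : Fin 4) :
    christoffel (nariaiWave Λ H) a b c x = waveChristoffel Λ H x a b c := by
  have hpd : ∀ i a b, pd i (fun y => nariaiWave Λ H y a b) x = metricGrad Λ H x a b i :=
    fun i a b => (hasGrad_nariaiWave hp hd a b).pd_eq i
  simp only [christoffel, hpd, nariaiWave_inv Λ H x hp, Fin.sum_univ_four]
  fin_cases a <;> fin_cases b <;> fin_cases c <;>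
    simp [metricGrad, waveChristoffel] <;> field_simp <;> ring

/-- The partial derivatives `∂_d Γ^a_bc` of the Christoffel symbols of the wave metric. -/
def waveChristoffelGrad (Λ : ℝ) (H : ℝ → ℂ → ℝ) (x : Pt) :
    Fin 4 → Matrix (Fin 4) (Fin 4) (Fin 4 → ℝ) :=
  let h := chartH H
  let p := chartP Λ x
  -- `w22` and `w33` are the gradients of `Λ * x 2 / P` and `Λ * x 3 / P`, from which all purely
  -- spatial Christoffel symbols are built.
  let w22 : Fin 4 → ℝ := ![0, 0, (Λ * p - Λ ^ 2 * x 2 ^ 2) / p ^ 2, -(Λ ^ 2 * x 2 * x 3) / p ^ 2]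
  let w33 : Fin 4 → ℝ := ![0, 0, -(Λ ^ 2 * x 2 * x 3) / p ^ 2, (Λ * p - Λ ^ 2 * x 3 ^ 2) / p ^ 2]
  let hh (i : Fin 4) : Fin 4 → ℝ := fun j => pd j (pd i h) x
  ![!![![0, Λ, 0, 0], 0, 0, 0;
      0, 0, 0, 0;
      0, 0, 0, 0;
      0, 0, 0, 0],
    !![fun j => hh 0 j / 2 + ![-(Λ * x 1 * pd 0 h x), Λ * (3 * Λ * x 1 ^ 2 - h x),
          -(Λ * x 1 * pd 2 h x), -(Λ * x 1 * pd 3 h x)] j, ![0, -Λ, 0, 0],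
        fun j => hh 2 j / 2, fun j => hh 3 j / 2;
      ![0, -Λ, 0, 0], 0, 0, 0;
      fun j => hh 2 j / 2, 0, 0, 0;
      fun j => hh 3 j / 2, 0, 0, 0],
    !![fun j => p ^ 2 * hh 2 j / 4 + ![0, 0, Λ * x 2, Λ * x 3] j * p * pd 2 h x / 2, 0, 0, 0;
      0, 0, 0, 0;
      0, 0, -w22, -w33;
      0, 0, -w33, w22],
    !![fun j => p ^ 2 * hh 3 j / 4 + ![0, 0, Λ * x 2, Λ * x 3] j * p * pd 3 h x / 2, 0, 0, 0;
      0, 0, 0, 0;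
      0, 0, w33, -w22;
      0, 0, -w22, -w33]]

theorem hasGrad_waveChristoffel {Λ : ℝ} {H : ℝ → ℂ → ℝ} {x : Pt} (hp : chartP Λ x ≠ 0)
    {R : Set Pt} (hR : IsOpen R) (hx : x ∈ R) (hH : ContDiffOn ℝ ∞ (chartH H) R) (a b c : Fin 4) :
    HasGrad (fun y => waveChristoffel Λ H y a b c) (waveChristoffelGrad Λ H x a b c) x := by
  have hh := hasGrad_of_contDiffOn hR hH hx
  have hhi : ∀ i, HasGrad (pd i (chartH H)) (fun j => pd j (pd i (chartH H)) x) x :=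
    fun i => hasGrad_of_contDiffOn hR (contDiffOn_pd hR hH i) hx
  have h1 := pd_one_chartH ((hH.contDiffAt (hR.mem_nhds hx)).differentiableAt (by simp))
  have hP := hasGrad_chartP Λ x
  have hhalf : ∀ i, HasGrad (fun y => pd i (chartH H) y / 2)
      (fun j => pd j (pd i (chartH H)) x / 2) x := fun i => by
    simpa [div_eq_inv_mul] using (hhi i).const_mul (2⁻¹)
  have hv : HasGrad (fun y => Λ * y 1) ![0, Λ, 0, 0] x :=
    ((HasGrad.coord 1).const_mul Λ).congr_grad fun i => by fin_cases i <;> simp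
  have hv' : HasGrad (fun y => -(Λ * y 1)) ![0, -Λ, 0, 0] x :=
    hv.neg.congr_grad fun i => by fin_cases i <;> simp
  have e00 : HasGrad (fun y => pd 0 (chartH H) y / 2 + Λ * y 1 * (Λ * y 1 ^ 2 - chartH H y))
      (fun j => pd j (pd 0 (chartH H)) x / 2 + ![-(Λ * x 1 * pd 0 (chartH H) x),
        Λ * (3 * Λ * x 1 ^ 2 - chartH H x),
        -(Λ * x 1 * pd 2 (chartH H) x), -(Λ * x 1 * pd 3 (chartH H) x)] j) x := by
    refine ((hhalf 0).add (hv.mul (((HasGrad.coord 1).pow_two.const_mul Λ).sub hh))).congr_grad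
      fun i => ?_
    fin_cases i <;> simp [h1] <;> ring
  have ep : ∀ k, HasGrad (fun y => chartP Λ y ^ 2 * pd k (chartH H) y / 4)
      (fun j => chartP Λ x ^ 2 * pd j (pd k (chartH H)) x / 4
        + ![0, 0, Λ * x 2, Λ * x 3] j * chartP Λ x * pd k (chartH H) x / 2) x := fun k => by
    have := ((hP.pow_two.mul (hhi k)).const_mul (4⁻¹))
    simp only [div_eq_inv_mul (_ * _) (4 : ℝ)]
    exact this.congr_grad fun i => by fin_cases i <;> simp <;> ring
  have w2 : HasGrad (fun y => Λ * y 2 / chartP Λ y) ![0, 0,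
      (Λ * chartP Λ x - Λ ^ 2 * x 2 ^ 2) / chartP Λ x ^ 2,
      -(Λ ^ 2 * x 2 * x 3) / chartP Λ x ^ 2] x := by
    refine (((HasGrad.coord 2).const_mul Λ).div hP hp).congr_grad fun i => ?_
    fin_cases i <;> simp <;> ring
  have w3 : HasGrad (fun y => Λ * y 3 / chartP Λ y) ![0, 0,
      -(Λ ^ 2 * x 2 * x 3) / chartP Λ x ^ 2,
      (Λ * chartP Λ x - Λ ^ 2 * x 3 ^ 2) / chartP Λ x ^ 2] x := by
    refine (((HasGrad.coord 3).const_mul Λ).div hP hp).congr_grad fun i => ?_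
    fin_cases i <;> simp <;> ring
  fin_cases a <;> fin_cases b <;> fin_cases c <;>
    first | exact hv | exact hv' | exact e00 | exact hhalf 2 | exact hhalf 3 | exact ep 2
          | exact ep 3 | exact w2 | exact w3 | exact w2.neg | exact w3.neg | exact HasGrad.const 0

/-- The components `R^a_bcd` of the wave metric, from the connection and its derivatives. -/
theorem riemann_nariaiWave {Λ : ℝ} {H : ℝ → ℂ → ℝ} {R : Set Pt} (hR : IsOpen R)
    (hp : ∀ x ∈ R, chartP Λ x ≠ 0) (hH : ContDiffOn ℝ ∞ (chartH H) R) {x : Pt} (hx : x ∈ R)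
    (a b c d : Fin 4) :
    riemann (nariaiWave Λ H) a b c d x =
      waveChristoffelGrad Λ H x a b d c - waveChristoffelGrad Λ H x a b c d
        + ∑ e, (waveChristoffel Λ H x a c e * waveChristoffel Λ H x e b d
          - waveChristoffel Λ H x a d e * waveChristoffel Λ H x e b c) := by
  have hG : ∀ y ∈ R, ∀ a b c, christoffel (nariaiWave Λ H) a b c y = waveChristoffel Λ H y a b c :=
    fun y hy => christoffel_nariaiWave (hp y hy)
      ((hH.contDiffAt (hR.mem_nhds hy)).differentiableAt (by simp))
  have hGe : ∀ a b c, christoffel (nariaiWave Λ H) a b c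
      =ᶠ[nhds x] fun y => waveChristoffel Λ H y a b c := fun a b c => by
    filter_upwards [hR.mem_nhds hx] with y hy using hG y hy a b c
  have hpd : ∀ a b c d, pd d (christoffel (nariaiWave Λ H) a b c) x
      = waveChristoffelGrad Λ H x a b c d := fun a b c d => by
    rw [pd_congr d (hGe a b c), (hasGrad_waveChristoffel (hp x hx) hR hx hH a b c).pd_eq]
  simp only [riemann, hpd, hG x hx]

/-! ### The curvature of the wave metric -/

section Curvature

variable {Λ : ℝ} {H : ℝ → ℂ → ℝ} {R : Set Pt} {x : Pt}

theorem pd_one_pd_chartH (hR : IsOpen R) (hH : ContDiffOn ℝ ∞ (chartH H) R) (hx : x ∈ R)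
    (i : Fin 4) : pd 1 (pd i (chartH H)) x = 0 := by
  rw [pd_comm hR hH hx, pd_congr (f₁ := fun _ => 0), (HasGrad.const 0).pd_eq]
  · rfl
  · filter_upwards [hR.mem_nhds hx] with y hy using
      pd_one_chartH ((hH.contDiffAt (hR.mem_nhds hy)).differentiableAt (by simp))

/-- Each factor of the background has Ricci tensor Λ times its metric, and the profile contributes
only its flat Laplacian, in the uu slot. The explicit form of P is needed only for the components
along the ζ-surface. -/
theorem ricci_nariaiWave (hR : IsOpen R)
    (hp : ∀ x ∈ R, chartP Λ x ≠ 0) (hH : ContDiffOn ℝ ∞ (chartH H) R) (hx : x ∈ R)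
    (b d : Fin 4) :
    ricci (nariaiWave Λ H) b d x = Λ * nariaiWave Λ H x b d +
      !![chartP Λ x ^ 2 / 4 * (pd 2 (pd 2 (chartH H)) x + pd 3 (pd 3 (chartH H)) x), 0, 0, 0;
        0, 0, 0, 0; 0, 0, 0, 0; 0, 0, 0, 0] b d := by
  have hpx := hp x hx
  have hP := chartP_eq Λ x
  have h1 := pd_one_pd_chartH hR hH hx
  simp only [ricci, riemann_nariaiWave hR hp hH hx, Fin.sum_univ_four, nariaiWave_eq]
  fin_cases b <;> fin_cases d <;>
    simp [waveChristoffel, waveChristoffelGrad, h1]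
  all_goals first
    | (field_simp; ring1)
    | (field_simp; linear_combination (2 * Λ) * hP)

/-- Since g^{uu} = 0, the profile term drops out of the trace. -/
theorem scalarCurvature_nariaiWave (hR : IsOpen R)
    (hp : ∀ x ∈ R, chartP Λ x ≠ 0) (hH : ContDiffOn ℝ ∞ (chartH H) R) (hx : x ∈ R) :
    scalarCurvature (nariaiWave Λ H) x = 4 * Λ := by
  have hpx := hp x hx
  simp only [scalarCurvature, ricci_nariaiWave hR hp hH hx, nariaiWave_inv Λ H x hpx,
    Fin.sum_univ_four]
  simp [nariaiWave_eq]
  field_simp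
  ring

/-- The Ricci term -Λ and the scalar term 4Λ/6 combine to the coefficient -Λ/3; the uu part of
Ricci, halved, gives the last term. In this form single components can be evaluated from the
connection tables. -/
theorem weyl_nariaiWave (hR : IsOpen R)
    (hp : ∀ x ∈ R, chartP Λ x ≠ 0) (hH : ContDiffOn ℝ ∞ (chartH H) R) (hx : x ∈ R)
    (a b c d : Fin 4) :
    weyl (nariaiWave Λ H) a b c d x =
      ∑ e, nariaiWave Λ H x a e * (waveChristoffelGrad Λ H x e b d c
        - waveChristoffelGrad Λ H x e b c d
        + ∑ f, (waveChristoffel Λ H x e c f * waveChristoffel Λ H x f b d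
          - waveChristoffel Λ H x e d f * waveChristoffel Λ H x f b c))
      - Λ / 3 * (nariaiWave Λ H x a c * nariaiWave Λ H x b d
        - nariaiWave Λ H x a d * nariaiWave Λ H x b c)
      - chartP Λ x ^ 2 / 8 * (pd 2 (pd 2 (chartH H)) x + pd 3 (pd 3 (chartH H)) x) *
        (nariaiWave Λ H x a c * !![1, 0, 0, 0; 0, 0, 0, 0; 0, 0, 0, 0; 0, 0, 0, 0] b d
        - nariaiWave Λ H x a d * !![1, 0, 0, 0; 0, 0, 0, 0; 0, 0, 0, 0; 0, 0, 0, 0] b c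
        - nariaiWave Λ H x b c * !![1, 0, 0, 0; 0, 0, 0, 0; 0, 0, 0, 0; 0, 0, 0, 0] a d
        + nariaiWave Λ H x b d * !![1, 0, 0, 0; 0, 0, 0, 0; 0, 0, 0, 0; 0, 0, 0, 0] a c) := by
  have hpp : ∀ b d : Fin 4, !![chartP Λ x ^ 2 / 4 *
      (pd 2 (pd 2 (chartH H)) x + pd 3 (pd 3 (chartH H)) x), 0, 0, 0;
        0, 0, 0, 0; 0, 0, 0, 0; 0, 0, 0, 0] b d = chartP Λ x ^ 2 / 4 *
      (pd 2 (pd 2 (chartH H)) x + pd 3 (pd 3 (chartH H)) x) *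
        !![1, 0, 0, 0; 0, 0, 0, 0; 0, 0, 0, 0; 0, 0, 0, 0] b d := by
    intro b d
    fin_cases b <;> fin_cases d <;> simp
  simp only [weyl, riemannLow, riemann_nariaiWave hR hp hH hx, ricci_nariaiWave hR hp hH hx,
    scalarCurvature_nariaiWave hR hp hH hx, hpp]
  ring

end Curvature

section Weyl

variable {Λ : ℝ} {H : ℝ → ℂ → ℝ} {R : Set Pt} {x : Pt}

/-- These are the components that enter Ψ₀ and Ψ₁, where k = ∂_v fills the first and third slots and
m the last. -/
theorem weyl_vv (hR : IsOpen R)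
    (hp : ∀ x ∈ R, chartP Λ x ≠ 0) (hH : ContDiffOn ℝ ∞ (chartH H) R) (hx : x ∈ R)
    (b : Fin 4) : weyl (nariaiWave Λ H) 1 b 1 2 x = 0 ∧ weyl (nariaiWave Λ H) 1 b 1 3 x = 0 := by
  have h1 := pd_one_pd_chartH hR hH hx
  have hpx := hp x hx
  simp only [weyl_nariaiWave hR hp hH hx, Fin.sum_univ_four, nariaiWave_eq]
  fin_cases b <;> simp [waveChristoffel, waveChristoffelGrad, h1]

theorem weyl_v_spatial_spatial (hR : IsOpen R)
    (hp : ∀ x ∈ R, chartP Λ x ≠ 0) (hH : ContDiffOn ℝ ∞ (chartH H) R) (hx : x ∈ R) :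
    weyl (nariaiWave Λ H) 1 2 2 1 x = 0 ∧ weyl (nariaiWave Λ H) 1 2 3 1 x = 0 ∧
    weyl (nariaiWave Λ H) 1 3 2 1 x = 0 ∧ weyl (nariaiWave Λ H) 1 3 3 1 x = 0 ∧
    weyl (nariaiWave Λ H) 1 2 2 0 x = -(2 * Λ) / (3 * chartP Λ x ^ 2) ∧
    weyl (nariaiWave Λ H) 1 3 3 0 x = -(2 * Λ) / (3 * chartP Λ x ^ 2) ∧
    weyl (nariaiWave Λ H) 1 2 3 0 x = 0 ∧ weyl (nariaiWave Λ H) 1 3 2 0 x = 0 := by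
  have h1 := pd_one_pd_chartH hR hH hx
  have hpx := hp x hx
  simp only [weyl_nariaiWave hR hp hH hx, Fin.sum_univ_four, nariaiWave_eq]
  refine ⟨?_, ?_, ?_, ?_, ?_, ?_, ?_, ?_⟩ <;>
    simp [waveChristoffel, waveChristoffelGrad, h1] <;> field_simp

theorem weyl_v_null_spatial (hR : IsOpen R)
    (hp : ∀ x ∈ R, chartP Λ x ≠ 0) (hH : ContDiffOn ℝ ∞ (chartH H) R) (hx : x ∈ R) :
    weyl (nariaiWave Λ H) 1 0 2 0 x = 0 ∧ weyl (nariaiWave Λ H) 1 0 3 0 x = 0 ∧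
    weyl (nariaiWave Λ H) 1 0 2 1 x = 0 ∧ weyl (nariaiWave Λ H) 1 0 3 1 x = 0 ∧
    weyl (nariaiWave Λ H) 1 1 2 0 x = 0 ∧ weyl (nariaiWave Λ H) 1 1 3 0 x = 0 ∧
    weyl (nariaiWave Λ H) 1 1 2 1 x = 0 ∧ weyl (nariaiWave Λ H) 1 1 3 1 x = 0 := by
  have h1 := pd_one_pd_chartH hR hH hx
  have hpx := hp x hx
  simp only [weyl_nariaiWave hR hp hH hx, Fin.sum_univ_four, nariaiWave_eq]
  refine ⟨?_, ?_, ?_, ?_, ?_, ?_, ?_, ?_⟩ <;>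
    simp [waveChristoffel, waveChristoffelGrad, h1]

theorem weyl_spatial_v_spatial (hR : IsOpen R)
    (hp : ∀ x ∈ R, chartP Λ x ≠ 0) (hH : ContDiffOn ℝ ∞ (chartH H) R) (hx : x ∈ R) :
    weyl (nariaiWave Λ H) 2 1 2 1 x = 0 ∧ weyl (nariaiWave Λ H) 2 1 3 1 x = 0 ∧
    weyl (nariaiWave Λ H) 3 1 2 1 x = 0 ∧ weyl (nariaiWave Λ H) 3 1 3 1 x = 0 ∧
    weyl (nariaiWave Λ H) 2 1 2 0 x = 2 * Λ / (3 * chartP Λ x ^ 2) ∧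
    weyl (nariaiWave Λ H) 3 1 3 0 x = 2 * Λ / (3 * chartP Λ x ^ 2) ∧
    weyl (nariaiWave Λ H) 2 1 3 0 x = 0 ∧ weyl (nariaiWave Λ H) 3 1 2 0 x = 0 := by
  have h1 := pd_one_pd_chartH hR hH hx
  have hpx := hp x hx
  simp only [weyl_nariaiWave hR hp hH hx, Fin.sum_univ_four, nariaiWave_eq]
  refine ⟨?_, ?_, ?_, ?_, ?_, ?_, ?_, ?_⟩ <;>
    simp [waveChristoffel, waveChristoffelGrad, h1] <;> field_simp

theorem weyl_spatial_u_spatial_v (hR : IsOpen R)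
    (hp : ∀ x ∈ R, chartP Λ x ≠ 0) (hH : ContDiffOn ℝ ∞ (chartH H) R) (hx : x ∈ R) :
    weyl (nariaiWave Λ H) 2 0 2 1 x = 2 * Λ / (3 * chartP Λ x ^ 2) ∧
    weyl (nariaiWave Λ H) 3 0 3 1 x = 2 * Λ / (3 * chartP Λ x ^ 2) ∧
    weyl (nariaiWave Λ H) 2 0 3 1 x = 0 ∧ weyl (nariaiWave Λ H) 3 0 2 1 x = 0 := by
  have h1 := pd_one_pd_chartH hR hH hx
  have hpx := hp x hx
  simp only [weyl_nariaiWave hR hp hH hx, Fin.sum_univ_four, nariaiWave_eq]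
  refine ⟨?_, ?_, ?_, ?_⟩ <;>
    simp [waveChristoffel, waveChristoffelGrad, h1] <;> field_simp

/-- The trace-free Hessian part, with its connection correction, is what Ψ₄ sees. The pure-trace
term in Λv² - H disappears on contraction with m̄ m̄, as m̄ is null. -/
theorem weyl_spatial_u_spatial_u (hR : IsOpen R)
    (hp : ∀ x ∈ R, chartP Λ x ≠ 0) (hH : ContDiffOn ℝ ∞ (chartH H) R) (hx : x ∈ R) :
    weyl (nariaiWave Λ H) 2 0 2 0 x =
      ((pd 2 (pd 2 (chartH H)) x - pd 3 (pd 3 (chartH H)) x) / 4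
        + Λ / (2 * chartP Λ x) * (x 2 * pd 2 (chartH H) x - x 3 * pd 3 (chartH H) x))
      - (Λ * x 1 ^ 2 - chartH H x) * (2 * Λ / (3 * chartP Λ x ^ 2)) ∧
    weyl (nariaiWave Λ H) 3 0 3 0 x =
      -((pd 2 (pd 2 (chartH H)) x - pd 3 (pd 3 (chartH H)) x) / 4
        + Λ / (2 * chartP Λ x) * (x 2 * pd 2 (chartH H) x - x 3 * pd 3 (chartH H) x))
      - (Λ * x 1 ^ 2 - chartH H x) * (2 * Λ / (3 * chartP Λ x ^ 2)) ∧
    weyl (nariaiWave Λ H) 2 0 3 0 x = pd 2 (pd 3 (chartH H)) x / 2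
        + Λ / (2 * chartP Λ x) * (x 2 * pd 3 (chartH H) x + x 3 * pd 2 (chartH H) x) ∧
    weyl (nariaiWave Λ H) 3 0 2 0 x = pd 2 (pd 3 (chartH H)) x / 2
        + Λ / (2 * chartP Λ x) * (x 2 * pd 3 (chartH H) x + x 3 * pd 2 (chartH H) x) := by
  have hpx := hp x hx
  have h32 := pd_comm hR hH hx 3 2
  simp only [weyl_nariaiWave hR hp hH hx, Fin.sum_univ_four, nariaiWave_eq]
  refine ⟨?_, ?_, ?_, ?_⟩ <;>
    simp [waveChristoffel, waveChristoffelGrad, h32] <;> field_simp <;> ring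

end Weyl

/-! ### Weyl scalars and Petrov type -/

section Scalars

variable {Λ : ℝ} {H : ℝ → ℂ → ℝ} {R : Set Pt} {x : Pt}

theorem naturalTetrad_k : (naturalTetrad Λ H x).k = ![0, 1, 0, 0] := rfl

theorem naturalTetrad_l :
    (naturalTetrad Λ H x).l = ![1, (Λ * x 1 ^ 2 - chartH H x) / 2, 0, 0] := rfl

theorem naturalTetrad_m : (naturalTetrad Λ H x).m
    = (![0, 0, (chartP Λ x : ℂ) / 2, Complex.I * chartP Λ x / 2] : Fin 4 → ℂ) := rfl

theorem conjVec_spatial (p : ℝ) :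
    conjVec (![0, 0, (p : ℂ) / 2, Complex.I * p / 2] : Fin 4 → ℂ)
      = (![0, 0, (p : ℂ) / 2, -(Complex.I * p / 2)] : Fin 4 → ℂ) := by
  have h2 : (starRingEnd ℂ) 2 = 2 := Complex.conj_ofNat 2
  ext i
  fin_cases i <;> simp [conjVec, h2]
  ring

theorem isNullTetrad_naturalTetrad (hp : chartP Λ x ≠ 0) :
    IsNullTetrad (nariaiWave Λ H) x (naturalTetrad Λ H x) := by
  have hp' : (chartP Λ x : ℂ) ≠ 0 := by exact_mod_cast hp
  constructor <;>
    simp [dotC, conjVec_spatial, naturalTetrad_m, naturalTetrad_l, naturalTetrad_k, toC, nariaiWave_eq, Fin.sum_univ_four]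
  · ring
  · field_simp
    linear_combination Complex.I_sq
  · field_simp
    linear_combination -Complex.I_sq

theorem psi0_naturalTetrad (hR : IsOpen R)
    (hp : ∀ x ∈ R, chartP Λ x ≠ 0) (hH : ContDiffOn ℝ ∞ (chartH H) R) (hx : x ∈ R) :
    Psi0 (nariaiWave Λ H) x (naturalTetrad Λ H x) = 0 := by
  have h := weyl_vv hR hp hH hx
  simp [Psi0, weylC, naturalTetrad, toC, Fin.sum_univ_four, fun b => (h b).1, fun b => (h b).2]

theorem psi1_naturalTetrad (hR : IsOpen R)
    (hp : ∀ x ∈ R, chartP Λ x ≠ 0) (hH : ContDiffOn ℝ ∞ (chartH H) R) (hx : x ∈ R) :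
    Psi1 (nariaiWave Λ H) x (naturalTetrad Λ H x) = 0 := by
  have h := weyl_vv hR hp hH hx
  simp [Psi1, weylC, naturalTetrad, toC, Fin.sum_univ_four, fun b => (h b).1, fun b => (h b).2]

theorem psi2_naturalTetrad (hR : IsOpen R)
    (hp : ∀ x ∈ R, chartP Λ x ≠ 0) (hH : ContDiffOn ℝ ∞ (chartH H) R) (hx : x ∈ R) :
    Psi2 (nariaiWave Λ H) x (naturalTetrad Λ H x) = -(Λ : ℂ) / 3 := by
  have hp' : (chartP Λ x : ℂ) ≠ 0 := by exact_mod_cast hp x hx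
  obtain ⟨h1, h2, h3, h4, h5, h6, h7, h8⟩ := weyl_v_spatial_spatial hR hp hH hx
  simp [Psi2, weylC, conjVec_spatial, naturalTetrad_m, naturalTetrad_l, naturalTetrad_k, toC, Fin.sum_univ_four, h1, h2, h3, h4, h5, h6, h7, h8]
  field_simp
  linear_combination (Λ : ℂ) * Complex.I_sq

theorem psi3_naturalTetrad (hR : IsOpen R)
    (hp : ∀ x ∈ R, chartP Λ x ≠ 0) (hH : ContDiffOn ℝ ∞ (chartH H) R) (hx : x ∈ R) :
    Psi3 (nariaiWave Λ H) x (naturalTetrad Λ H x) = 0 := by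
  obtain ⟨h1, h2, h3, h4, h5, h6, h7, h8⟩ := weyl_v_null_spatial hR hp hH hx
  simp [Psi3, weylC, naturalTetrad, toC, conjVec, Fin.sum_univ_four,
    h1, h2, h3, h4, h5, h6, h7, h8]

theorem psi4_naturalTetrad (hR : IsOpen R)
    (hp : ∀ x ∈ R, chartP Λ x ≠ 0) (hH : ContDiffOn ℝ ∞ (chartH H) R) (hx : x ∈ R) :
    Psi4 (nariaiWave Λ H) x (naturalTetrad Λ H x) = (chartP Λ x : ℂ) ^ 2 / 2 *
      ((pd 2 (pd 2 (chartH H)) x - pd 3 (pd 3 (chartH H)) x) / 4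
        + Λ / (2 * chartP Λ x) * (x 2 * pd 2 (chartH H) x - x 3 * pd 3 (chartH H) x)
      - Complex.I * (pd 2 (pd 3 (chartH H)) x / 2
        + Λ / (2 * chartP Λ x) * (x 2 * pd 3 (chartH H) x + x 3 * pd 2 (chartH H) x))) := by
  have hp' : (chartP Λ x : ℂ) ≠ 0 := by exact_mod_cast hp x hx
  obtain ⟨h1, h2, h3, h4, h5, h6, h7, h8⟩ := weyl_spatial_v_spatial hR hp hH hx
  obtain ⟨k1, k2, k3, k4⟩ := weyl_spatial_u_spatial_v hR hp hH hx
  obtain ⟨l1, l2, l3, l4⟩ := weyl_spatial_u_spatial_u hR hp hH hx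
  simp [Psi4, weylC, conjVec_spatial, naturalTetrad_m, naturalTetrad_l, toC, Fin.sum_univ_four,
    h1, h2, h3, h4, h5, h6, h7, h8, k1, k2, k3, k4, l1, l2, l3, l4]
  field_simp
  ring_nf
  simp only [Complex.I_sq]
  ring

/-- The quartic is b²(-2Λa² + Ψ₄b²) = b²(αa + βb)(αa - βb) with α² = -2Λ and β² = -Ψ₄. Nonvanishing
of Λ separates the double root from the others, and nonvanishing of both separates the simple ones.
-/
theorem isPetrovTypeII_of_psi4_ne_zero (hΛ : Λ ≠ 0) (hR : IsOpen R)
    (hp : ∀ x ∈ R, chartP Λ x ≠ 0) (hH : ContDiffOn ℝ ∞ (chartH H) R) (hx : x ∈ R)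
    (h4 : Psi4 (nariaiWave Λ H) x (naturalTetrad Λ H x) ≠ 0) :
    IsPetrovTypeII (nariaiWave Λ H) x := by
  obtain ⟨α, hα⟩ := IsAlgClosed.exists_pow_nat_eq (-(2 * (Λ : ℂ))) (n := 2) (by norm_num)
  obtain ⟨β, hβ⟩ := IsAlgClosed.exists_pow_nat_eq
    (-Psi4 (nariaiWave Λ H) x (naturalTetrad Λ H x)) (n := 2) (by norm_num)
  have hα0 : α ≠ 0 := by
    rintro rfl
    have : (Λ : ℂ) = 0 := by linear_combination (1 / 2 : ℂ) * hα
    exact hΛ (by exact_mod_cast this)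
  have hβ0 : β ≠ 0 := by
    rintro rfl
    exact h4 (by linear_combination hβ)
  refine ⟨_, isNullTetrad_naturalTetrad (hp x hx), 0, 1, α, β, α, -β, ?_, ?_, ?_, fun a b => ?_⟩
  · simpa using hα0.symm
  · simpa using hα0.symm
  · intro h
    have : α * β = 0 := by linear_combination (-1 / 2 : ℂ) * h
    exact mul_ne_zero hα0 hβ0 this
  · rw [weylQuartic, psi0_naturalTetrad hR hp hH hx, psi1_naturalTetrad hR hp hH hx,
      psi2_naturalTetrad hR hp hH hx, psi3_naturalTetrad hR hp hH hx]
    linear_combination (-(a ^ 2 * b ^ 2)) * hα + b ^ 4 * hβ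

end Scalars

/-! ### The null Maxwell field -/

section Maxwell

variable {Λ : ℝ} {H : ℝ → ℂ → ℝ} {Φ : Pt → ℂ} {x : Pt}

/-- The real part of the rescaled field component `Φ₂ / P`. -/
def fieldRe (Λ : ℝ) (Φ : Pt → ℂ) (x : Pt) : ℝ := (Φ x).re / chartP Λ x

/-- The imaginary part of the rescaled field component `Φ₂ / P`. -/
def fieldIm (Λ : ℝ) (Φ : Pt → ℂ) (x : Pt) : ℝ := (Φ x).im / chartP Λ x

/-- Lowering indices gives k = -du and m = dζ/P, so F is the real part of -2(Φ₂/P) du ∧ dζ. -/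
theorem nariaiNullField_eq (hp : chartP Λ x ≠ 0) (a b : Fin 4) : nariaiNullField Λ H Φ x a b =
    !![0, 0, -(2 * fieldRe Λ Φ x), 2 * fieldIm Λ Φ x;
      0, 0, 0, 0;
      2 * fieldRe Λ Φ x, 0, 0, 0;
      -(2 * fieldIm Λ Φ x), 0, 0, 0] a b := by
  have hp' : (chartP Λ x : ℂ) ≠ 0 := by exact_mod_cast hp
  have hk : ∀ a, lower (nariaiWave Λ H) x (toC (naturalTetrad Λ H x).k) a
      = (![-1, 0, 0, 0] : Fin 4 → ℂ) a := fun a => by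
    fin_cases a <;> simp [lower, naturalTetrad_k, toC, nariaiWave_eq, Fin.sum_univ_four]
  have hm : ∀ a, lower (nariaiWave Λ H) x (naturalTetrad Λ H x).m a
      = (![0, 0, ((chartP Λ x)⁻¹ : ℝ), Complex.I * ((chartP Λ x)⁻¹ : ℝ)] : Fin 4 → ℂ) a :=
    fun a => by
      fin_cases a <;> simp [lower, naturalTetrad_m, nariaiWave_eq, Fin.sum_univ_four] <;>
        field_simp
  simp only [nariaiNullField, nullField, Matrix.of_apply, hk, hm]
  fin_cases a <;> fin_cases b <;>
    simp [fieldRe, fieldIm, div_eq_mul_inv, -Complex.ofReal_inv] <;> ring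

end Maxwell

section MaxwellEquations

variable {Λ : ℝ} {H : ℝ → ℂ → ℝ} {Φ : Pt → ℂ} {R : Set Pt} {x : Pt}

theorem raised_nariaiNullField (hp : chartP Λ x ≠ 0) (a b : Fin 4) :
    raised (nariaiWave Λ H) (nariaiNullField Λ H Φ) a b x =
    !![0, 0, 0, 0;
      0, 0, chartP Λ x ^ 2 * fieldRe Λ Φ x, -(chartP Λ x ^ 2 * fieldIm Λ Φ x);
      0, -(chartP Λ x ^ 2 * fieldRe Λ Φ x), 0, 0;
      0, chartP Λ x ^ 2 * fieldIm Λ Φ x, 0, 0] a b := by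
  simp only [raised, nariaiWave_inv Λ H x hp, nariaiNullField_eq hp, Fin.sum_univ_four]
  fin_cases a <;> fin_cases b <;> simp <;> ring

/-- The invariant F_ab F^ab of a null field is zero, so only the k_a k_b term is left. -/
theorem maxwellStress_nariaiNullField (hp : chartP Λ x ≠ 0) (a b : Fin 4) :
    maxwellStress (nariaiWave Λ H) (nariaiNullField Λ H Φ) a b x =
    !![2 * chartP Λ x ^ 2 * (fieldRe Λ Φ x ^ 2 + fieldIm Λ Φ x ^ 2), 0, 0, 0;
      0, 0, 0, 0; 0, 0, 0, 0; 0, 0, 0, 0] a b := by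
  simp only [maxwellStress, nariaiWave_inv Λ H x hp, nariaiNullField_eq hp,
    raised_nariaiNullField hp, Fin.sum_univ_four]
  fin_cases a <;> fin_cases b <;> simp
  ring

theorem contDiff_chartP (Λ : ℝ) : ContDiff ℝ ∞ (chartP Λ) := by
  have h : chartP Λ = fun x => 1 + Λ / 2 * (x 2 * x 2 + x 3 * x 3) := funext (chartP_eq Λ)
  have h2 : ContDiff ℝ ∞ fun x : Pt => x 2 := contDiff_apply ℝ ℝ (2 : Fin 4)
  have h3 : ContDiff ℝ ∞ fun x : Pt => x 3 := contDiff_apply ℝ ℝ (3 : Fin 4)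
  rw [h]
  exact contDiff_const.add (contDiff_const.mul ((h2.mul h2).add (h3.mul h3)))

theorem contDiffOn_fieldRe (hp : ∀ x ∈ R, chartP Λ x ≠ 0) (hΦ : ContDiffOn ℝ ∞ Φ R) :
    ContDiffOn ℝ ∞ (fieldRe Λ Φ) R :=
  (Complex.reCLM.contDiff.comp_contDiffOn hΦ).div (contDiff_chartP Λ).contDiffOn hp

theorem contDiffOn_fieldIm (hp : ∀ x ∈ R, chartP Λ x ≠ 0) (hΦ : ContDiffOn ℝ ∞ Φ R) :
    ContDiffOn ℝ ∞ (fieldIm Λ Φ) R :=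
  (Complex.imCLM.contDiff.comp_contDiffOn hΦ).div (contDiff_chartP Λ).contDiffOn hp

theorem pd_nariaiNullField (hR : IsOpen R) (hp : ∀ x ∈ R, chartP Λ x ≠ 0)
    (hΦ : ContDiffOn ℝ ∞ Φ R) (hx : x ∈ R) (i a b : Fin 4) :
    pd i (fun y => nariaiNullField Λ H Φ y a b) x =
    !![0, 0, -(2 * pd i (fieldRe Λ Φ) x), 2 * pd i (fieldIm Λ Φ) x;
      0, 0, 0, 0;
      2 * pd i (fieldRe Λ Φ) x, 0, 0, 0;
      -(2 * pd i (fieldIm Λ Φ) x), 0, 0, 0] a b := by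
  have e : (fun y => nariaiNullField Λ H Φ y a b) =ᶠ[nhds x] fun y =>
      !![0, 0, -(2 * fieldRe Λ Φ y), 2 * fieldIm Λ Φ y;
      0, 0, 0, 0;
      2 * fieldRe Λ Φ y, 0, 0, 0;
      -(2 * fieldIm Λ Φ y), 0, 0, 0] a b := by
    filter_upwards [hR.mem_nhds hx] with y hy using nariaiNullField_eq (hp y hy) a b
  have h1 := (hasGrad_of_contDiffOn hR (contDiffOn_fieldRe hp hΦ) hx).const_mul 2
  have h2 := (hasGrad_of_contDiffOn hR (contDiffOn_fieldIm hp hΦ) hx).const_mul 2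
  rw [pd_congr i e]
  fin_cases a <;> fin_cases b <;>
    first
    | exact (HasGrad.const 0).pd_eq i
    | exact h1.pd_eq i
    | exact h2.pd_eq i
    | exact h1.neg.pd_eq i
    | exact h2.neg.pd_eq i

theorem pd_raised_nariaiNullField (hR : IsOpen R) (hp : ∀ x ∈ R, chartP Λ x ≠ 0)
    (hΦ : ContDiffOn ℝ ∞ Φ R) (hx : x ∈ R) (i a b : Fin 4) :
    pd i (raised (nariaiWave Λ H) (nariaiNullField Λ H Φ) a b) x =
    (let dp : Fin 4 → ℝ := ![0, 0, Λ * x 2, Λ * x 3]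
    let r := 2 * chartP Λ x * dp i * fieldRe Λ Φ x + chartP Λ x ^ 2 * pd i (fieldRe Λ Φ) x
    let s := 2 * chartP Λ x * dp i * fieldIm Λ Φ x + chartP Λ x ^ 2 * pd i (fieldIm Λ Φ) x
    !![0, 0, 0, 0; 0, 0, r, -s; 0, -r, 0, 0; 0, s, 0, 0] a b) := by
  have e : raised (nariaiWave Λ H) (nariaiNullField Λ H Φ) a b =ᶠ[nhds x] fun y =>
      !![0, 0, 0, 0;
      0, 0, chartP Λ y ^ 2 * fieldRe Λ Φ y, -(chartP Λ y ^ 2 * fieldIm Λ Φ y);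
      0, -(chartP Λ y ^ 2 * fieldRe Λ Φ y), 0, 0;
      0, chartP Λ y ^ 2 * fieldIm Λ Φ y, 0, 0] a b := by
    filter_upwards [hR.mem_nhds hx] with y hy using raised_nariaiNullField (hp y hy) a b
  have hP := (hasGrad_chartP Λ x).pow_two
  have h1 := hP.mul (hasGrad_of_contDiffOn hR (contDiffOn_fieldRe hp hΦ) hx)
  have h2 := hP.mul (hasGrad_of_contDiffOn hR (contDiffOn_fieldIm hp hΦ) hx)
  rw [pd_congr i e]
  fin_cases a <;> fin_cases b <;>
    first
    | exact (HasGrad.const 0).pd_eq i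
    | exact h1.pd_eq i
    | exact h2.pd_eq i
    | exact h1.neg.pd_eq i
    | exact h2.neg.pd_eq i

theorem divergence_nariaiNullField (hR : IsOpen R) (hp : ∀ x ∈ R, chartP Λ x ≠ 0)
    (hH : ContDiffOn ℝ ∞ (chartH H) R) (hΦ : ContDiffOn ℝ ∞ Φ R) (hx : x ∈ R) (a : Fin 4) :
    divergence (nariaiWave Λ H) (nariaiNullField Λ H Φ) a x = chartP Λ x ^ 2 *
      ![0, pd 2 (fieldRe Λ Φ) x - pd 3 (fieldIm Λ Φ) x, -pd 1 (fieldRe Λ Φ) x,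
        pd 1 (fieldIm Λ Φ) x] a := by
  have hpx := hp x hx
  have hd := (hH.contDiffAt (hR.mem_nhds hx)).differentiableAt (n := ∞) (by simp)
  simp only [divergence, christoffel_nariaiWave hpx hd, raised_nariaiNullField hpx,
    pd_raised_nariaiNullField hR hp hΦ hx, Fin.sum_univ_four]
  fin_cases a <;> simp [waveChristoffel] <;> field_simp <;> ring

/-- For the null field, the Maxwell equations are the independence of `v` and the Cauchy-Riemann
equations of `Φ₂ / P`. -/
theorem isMaxwellField_iff (hR : IsOpen R) (hp : ∀ x ∈ R, chartP Λ x ≠ 0)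
    (hH : ContDiffOn ℝ ∞ (chartH H) R) (hΦ : ContDiffOn ℝ ∞ Φ R) :
    IsMaxwellField (nariaiWave Λ H) (nariaiNullField Λ H Φ) R ↔ ∀ x ∈ R,
      pd 1 (fieldRe Λ Φ) x = 0 ∧ pd 1 (fieldIm Λ Φ) x = 0 ∧
      pd 2 (fieldRe Λ Φ) x = pd 3 (fieldIm Λ Φ) x ∧
      pd 3 (fieldRe Λ Φ) x = -pd 2 (fieldIm Λ Φ) x := by
  constructor
  · intro h x hx
    have hpx := pow_ne_zero 2 (hp x hx)
    have hdiv := h.divergence_free x hx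
    simp only [divergence_nariaiNullField hR hp hH hΦ hx] at hdiv
    -- The v-component of the divergence is one Cauchy-Riemann equation and the spatial components
    -- give independence of v; the other Cauchy-Riemann equation is the (u, x, y) component of dF =
    -- 0.
    have d1 := hdiv 1
    have d2 := hdiv 2
    have d3 := hdiv 3
    have hc := h.closed x hx 0 2 3
    simp [pd_nariaiNullField hR hp hΦ hx] at hc
    simp [hp x hx] at d1 d2 d3
    exact ⟨d2, d3, by linarith, by linarith⟩
  · intro h
    refine ⟨fun x hx a b => ?_, fun x hx a b c => ?_, fun x hx a => ?_⟩
    · simp only [nariaiNullField_eq (hp x hx)]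
      fin_cases a <;> fin_cases b <;> simp
    · obtain ⟨h1, h2, h3, h4⟩ := h x hx
      simp only [pd_nariaiNullField hR hp hΦ hx]
      fin_cases a <;> fin_cases b <;> fin_cases c <;> simp [h1, h2, h3, h4]
    · obtain ⟨h1, h2, h3, h4⟩ := h x hx
      rw [divergence_nariaiNullField hR hp hH hΦ hx]
      fin_cases a <;> simp [h1, h2, h3]

/-- For the null field, Einstein's equations reduce to a single equation for the profile. -/
theorem einstein_iff (hR : IsOpen R) (hp : ∀ x ∈ R, chartP Λ x ≠ 0)
    (hH : ContDiffOn ℝ ∞ (chartH H) R) :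
    (∀ x ∈ R, ∀ a b, ricci (nariaiWave Λ H) a b x
      - (1 / 2) * scalarCurvature (nariaiWave Λ H) x * nariaiWave Λ H x a b
      + Λ * nariaiWave Λ H x a b
        = maxwellStress (nariaiWave Λ H) (nariaiNullField Λ H Φ) a b x) ↔
    ∀ x ∈ R, pd 2 (pd 2 (chartH H)) x + pd 3 (pd 3 (chartH H)) x
      = 8 * (fieldRe Λ Φ x ^ 2 + fieldIm Λ Φ x ^ 2) := by
  refine forall₂_congr fun x hx => ?_
  have hpx := hp x hx
  simp only [ricci_nariaiWave hR hp hH hx, scalarCurvature_nariaiWave hR hp hH hx,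
    maxwellStress_nariaiNullField hpx]
  constructor
  · intro h
    have h0 := h 0 0
    simp at h0
    have h1 : chartP Λ x ^ 2 * (pd 2 (pd 2 (chartH H)) x + pd 3 (pd 3 (chartH H)) x
        - 8 * (fieldRe Λ Φ x ^ 2 + fieldIm Λ Φ x ^ 2)) = 0 := by linear_combination 4 * h0
    have := (mul_eq_zero.1 h1).resolve_left (pow_ne_zero 2 hpx)
    linarith
  · intro h a b
    -- With R = 4Λ the background satisfies the vacuum equation, so all multiples of the metric
    -- cancel.
    have : Λ * nariaiWave Λ H x a b - 1 / 2 * (4 * Λ) * nariaiWave Λ H x a b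
      + Λ * nariaiWave Λ H x a b = 0 := by ring
    rw [h]
    fin_cases a <;> fin_cases b <;> simp at this ⊢ <;> linear_combination this

end MaxwellEquations

/-! ### Wirtinger derivatives of functions on the chart -/

section Bridge

theorem pt_coords (x : Pt) : pt (uCoord x) (x 1) (zCoord x) = x := by
  ext i
  fin_cases i <;> rfl

@[simp] theorem uCoord_pt (u v : ℝ) (ζ : ℂ) : uCoord (pt u v ζ) = u := rfl

@[simp] theorem zCoord_pt (u v : ℝ) (ζ : ℂ) : zCoord (pt u v ζ) = ζ := rfl

theorem pt_mem_region {I : Set ℝ} {Ω : Set ℂ} {u : ℝ} {ζ : ℂ} (hu : u ∈ I) (hζ : ζ ∈ Ω) (v : ℝ) :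
    pt u v ζ ∈ region I Ω := ⟨hu, hζ⟩

theorem contDiff_pt (v : ℝ) : ContDiff ℝ ∞ fun p : ℝ × ℂ => pt p.1 v p.2 := by
  rw [contDiff_pi]
  intro i
  fin_cases i
  · exact contDiff_fst
  · exact contDiff_const
  · exact Complex.reCLM.contDiff.comp contDiff_snd
  · exact Complex.imCLM.contDiff.comp contDiff_snd

theorem hasWirtinger_comp_pt {f : Pt → ℝ} {g : Fin 4 → ℝ} {u v : ℝ} {ζ : ℂ}
    (hf : HasGrad f g (pt u v ζ)) :
    HasWirtinger (fun w => (f (pt u v w) : ℂ)) ((1 / 2) * (g 2 - Complex.I * g 3))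
      ((1 / 2) * (g 2 + Complex.I * g 3)) ζ := by
  have hpt : HasFDerivAt (fun w => pt u v w)
      (ContinuousLinearMap.pi ![(0 : ℂ →L[ℝ] ℝ), 0, Complex.reCLM, Complex.imCLM]) ζ := by
    rw [hasFDerivAt_pi']
    intro i
    fin_cases i
    · exact hasFDerivAt_const u ζ
    · exact hasFDerivAt_const v ζ
    · exact Complex.reCLM.hasFDerivAt
    · exact Complex.imCLM.hasFDerivAt
  have h := Complex.ofRealCLM.hasFDerivAt.comp ζ (HasFDerivAt.comp ζ hf hpt)
  have h' := HasWirtinger.of_fderiv h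
  refine HasWirtinger.congr_deriv (φ := fun w => (f (pt u v w) : ℂ)) h' ?_ ?_ <;>
    simp [Fin.sum_univ_four]

theorem hasWirtinger_nariaiP (Λ : ℝ) (ζ : ℂ) : HasWirtinger (fun w => (nariaiP Λ w : ℂ))
    (Λ / 2 * (starRingEnd ℂ) ζ) (Λ / 2 * ζ) ζ := by
  have h : (fun w => (nariaiP Λ w : ℂ)) = fun w => 1 + (Λ / 2 : ℂ) * (w * (starRingEnd ℂ) w) := by
    ext w
    rw [Complex.mul_conj]
    simp [nariaiP]
  rw [h]
  exact ((HasWirtinger.const 1 ζ).add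
    (((HasWirtinger.id ζ).mul (HasWirtinger.id ζ).conj).const_mul (Λ / 2 : ℂ))).congr_deriv
    (by simp) (by simp)

variable {I : Set ℝ} {Ω : Set ℂ} {H : ℝ → ℂ → ℝ}

theorem hasWirtinger_profile (hI : IsOpen I) (hΩ : IsOpen Ω) (hH : IsSmoothProfile I Ω H)
    {x : Pt} (hx : x ∈ region I Ω) :
    HasWirtinger (fun ζ => (H (uCoord x) ζ : ℂ))
      ((1 / 2) * (pd 2 (chartH H) x - Complex.I * pd 3 (chartH H) x))
      ((1 / 2) * (pd 2 (chartH H) x + Complex.I * pd 3 (chartH H) x)) (zCoord x) := by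
  have h := hasGrad_of_contDiffOn (isOpen_region hI hΩ) (contDiffOn_chartH hH) hx
  rw [← pt_coords x] at h
  have := hasWirtinger_comp_pt h
  rwa [pt_coords x] at this

theorem dzeta_profile (hI : IsOpen I) (hΩ : IsOpen Ω) (hH : IsSmoothProfile I Ω H)
    {u v : ℝ} {ζ : ℂ} (hu : u ∈ I) (hζ : ζ ∈ Ω) :
    dzeta (fun ζ => (H u ζ : ℂ)) ζ
      = (1 / 2) * (pd 2 (chartH H) (pt u v ζ) - Complex.I * pd 3 (chartH H) (pt u v ζ)) :=
  (hasWirtinger_profile hI hΩ hH (pt_mem_region hu hζ v)).dzeta_eq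

theorem hasWirtinger_profile' (hI : IsOpen I) (hΩ : IsOpen Ω) (hH : IsSmoothProfile I Ω H)
    {u : ℝ} {ζ : ℂ} (hu : u ∈ I) (hζ : ζ ∈ Ω) :
    HasWirtinger (fun ζ => (H u ζ : ℂ)) (dzeta (fun ζ => (H u ζ : ℂ)) ζ)
      ((starRingEnd ℂ) (dzeta (fun ζ => (H u ζ : ℂ)) ζ)) ζ := by
  have h := hasWirtinger_profile hI hΩ hH (pt_mem_region hu hζ 0)
  rw [dzeta_profile hI hΩ hH (v := 0) hu hζ]
  refine h.congr_deriv rfl ?_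
  have h2 : (starRingEnd ℂ) 2 = 2 := Complex.conj_ofNat 2
  simp [h2]

/-- The second coefficient is ∂_ζ̄∂_ζ = ¼(∂_x² + ∂_y²), through which Einstein's equation becomes a
statement about ζ and ζ̄. Symmetry of the mixed partials is used. -/
theorem hasWirtinger_dzeta_profile (hI : IsOpen I) (hΩ : IsOpen Ω) (hH : IsSmoothProfile I Ω H)
    {x : Pt} (hx : x ∈ region I Ω) :
    HasWirtinger (dzeta fun ζ => (H (uCoord x) ζ : ℂ))
      ((1 / 4) * (pd 2 (pd 2 (chartH H)) x - pd 3 (pd 3 (chartH H)) x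
        - 2 * Complex.I * pd 2 (pd 3 (chartH H)) x))
      ((1 / 4) * (pd 2 (pd 2 (chartH H)) x + pd 3 (pd 3 (chartH H)) x)) (zCoord x) := by
  have hR := isOpen_region hI hΩ
  have hc := contDiffOn_chartH hH
  have h (i : Fin 4) := hasGrad_of_contDiffOn hR (contDiffOn_pd hR hc i) hx
  rw [← pt_coords x] at h
  have h2 := hasWirtinger_comp_pt (h 2)
  have h3 := hasWirtinger_comp_pt (h 3)
  rw [pt_coords x] at h2 h3
  have h32 := pd_comm hR hc hx 3 2
  refine (((h2.sub (h3.const_mul Complex.I)).const_mul (1 / 2)).congr ?_).congr_deriv ?_ ?_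
  · filter_upwards [hΩ.mem_nhds hx.2] with ζ hζ
    exact dzeta_profile hI hΩ hH hx.1 hζ
  · rw [h32]
    linear_combination (pd 3 (pd 3 (chartH H)) x / 4 : ℂ) * Complex.I_sq
  · rw [h32]
    linear_combination (-pd 3 (pd 3 (chartH H)) x / 4 : ℂ) * Complex.I_sq

/-- Because P_ζζ = 0, the product rule leaves 2P_ζ H_ζ + P H_ζζ with P_ζ = Λζ̄/2. -/
theorem dzeta_dzeta_mul_profile {Λ : ℝ} (hI : IsOpen I) (hΩ : IsOpen Ω)
    (hH : IsSmoothProfile I Ω H) {x : Pt} (hx : x ∈ region I Ω) :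
    dzeta (dzeta fun ζ => (nariaiP Λ ζ : ℂ) * (H (uCoord x) ζ : ℂ)) (zCoord x) =
      Λ * (starRingEnd ℂ) (zCoord x) *
        ((1 / 2) * (pd 2 (chartH H) x - Complex.I * pd 3 (chartH H) x))
      + chartP Λ x * ((1 / 4) * (pd 2 (pd 2 (chartH H)) x - pd 3 (pd 3 (chartH H)) x
        - 2 * Complex.I * pd 2 (pd 3 (chartH H)) x)) := by
  have e : ∀ ζ ∈ Ω, dzeta (fun ζ => (nariaiP Λ ζ : ℂ) * (H (uCoord x) ζ : ℂ)) ζ =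
      (Λ / 2 * (starRingEnd ℂ) ζ) * (H (uCoord x) ζ : ℂ)
        + nariaiP Λ ζ * dzeta (fun ζ => (H (uCoord x) ζ : ℂ)) ζ := fun ζ hζ =>
    ((hasWirtinger_nariaiP Λ ζ).mul (hasWirtinger_profile' hI hΩ hH hx.1 hζ)).dzeta_eq
  have h := ((((HasWirtinger.id (zCoord x)).conj.const_mul (Λ / 2 : ℂ)).mul
    (hasWirtinger_profile hI hΩ hH hx)).add ((hasWirtinger_nariaiP Λ (zCoord x)).mul
      (hasWirtinger_dzeta_profile hI hΩ hH hx)))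
  have h' := h.congr (ψ := dzeta fun ζ => (nariaiP Λ ζ : ℂ) * (H (uCoord x) ζ : ℂ)) (by
    filter_upwards [hΩ.mem_nhds hx.2] with ζ hζ using e ζ hζ)
  rw [h'.dzeta_eq]
  have hd := (hasWirtinger_profile hI hΩ hH hx).dzeta_eq
  rw [hd]
  simp only [map_zero, chartP]
  ring

end Bridge

/-! ### Solutions of the Maxwell equations -/

section MaxwellSolutions

variable {Λ : ℝ} {I : Set ℝ} {Ω : Set ℂ} {H : ℝ → ℂ → ℝ} {Φ : Pt → ℂ} {E : ℝ → ℂ → ℂ}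

theorem nullComponent_eq {x : Pt} (hp : chartP Λ x ≠ 0) :
    nullComponent Λ E x = E (uCoord x) (zCoord x) * chartP Λ x := by
  have hp' : (chartP Λ x : ℂ) ≠ 0 := by exact_mod_cast hp
  show E (uCoord x) (zCoord x) * (chartP Λ x : ℂ) ^ 3 / (chartP Λ x : ℂ) ^ 2 = _
  field_simp

theorem fieldRe_eq {x : Pt} (hp : chartP Λ x ≠ 0) (h : Φ x = nullComponent Λ E x) :
    fieldRe Λ Φ x = (E (uCoord x) (zCoord x)).re := by
  rw [fieldRe, h, nullComponent_eq hp, Complex.re_mul_ofReal, mul_div_cancel_right₀ _ hp]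

theorem fieldIm_eq {x : Pt} (hp : chartP Λ x ≠ 0) (h : Φ x = nullComponent Λ E x) :
    fieldIm Λ Φ x = (E (uCoord x) (zCoord x)).im := by
  rw [fieldIm, h, nullComponent_eq hp, Complex.im_mul_ofReal, mul_div_cancel_right₀ _ hp]

theorem eq_of_pd_one_eq_zero {f : Pt → ℝ} {u : ℝ} {ζ : ℂ}
    (hd : ∀ v, DifferentiableAt ℝ f (pt u v ζ)) (h0 : ∀ v, pd 1 f (pt u v ζ) = 0) (v w : ℝ) :
    f (pt u v ζ) = f (pt u w ζ) := by
  have hder : ∀ t, HasDerivAt (fun t => f (pt u t ζ)) 0 t := by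
    intro t
    have hl : HasDerivAt (fun t : ℝ => pt u t ζ) (Pi.single 1 1 : Pt) t := by
      rw [hasDerivAt_pi]
      intro i
      fin_cases i
      · exact hasDerivAt_const t u
      · exact hasDerivAt_id t
      · exact hasDerivAt_const t ζ.re
      · exact hasDerivAt_const t ζ.im
    have := (hd t).hasFDerivAt.comp_hasDerivAt t hl
    rwa [show fderiv ℝ f (pt u t ζ) (Pi.single 1 1) = 0 from h0 t] at this
  exact is_const_of_deriv_eq_zero (fun t => (hder t).differentiableAt) (fun t => (hder t).deriv) v w

/-- The profile is Φ₂/P restricted to v = 0; v ranges over a whole line, so independence of v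
recovers Φ₂ everywhere. -/
theorem isMaxwellField_iff_exists (hI : IsOpen I) (hΩ : IsOpen Ω)
    (hp : ∀ ζ ∈ Ω, nariaiP Λ ζ ≠ 0) (hH : IsSmoothProfile I Ω H)
    (hΦ : ContDiffOn ℝ ∞ Φ (region I Ω)) :
    IsMaxwellField (nariaiWave Λ H) (nariaiNullField Λ H Φ) (region I Ω) ↔
      ∃ E : ℝ → ℂ → ℂ, IsHolomorphicProfile I Ω E ∧
        ∀ x ∈ region I Ω, Φ x = nullComponent Λ E x := by
  have hR := isOpen_region hI hΩ
  have hp' : ∀ x ∈ region I Ω, chartP Λ x ≠ 0 := fun x hx => hp _ hx.2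
  have hre := contDiffOn_fieldRe hp' hΦ
  have him := contDiffOn_fieldIm hp' hΦ
  rw [isMaxwellField_iff hR hp' (contDiffOn_chartH hH) hΦ]
  constructor
  · intro h
    let E : ℝ → ℂ → ℂ := fun u ζ =>
      fieldRe Λ Φ (pt u 0 ζ) + Complex.I * fieldIm Λ Φ (pt u 0 ζ)
    refine ⟨E, ⟨?_, fun u hu ζ hζ => ?_⟩, fun x hx => ?_⟩
    · have hm : Set.MapsTo (fun p : ℝ × ℂ => pt p.1 0 p.2) (I ×ˢ Ω) (region I Ω) :=
        fun p hp => pt_mem_region hp.1 hp.2 0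
      exact (Complex.ofRealCLM.contDiff.comp_contDiffOn
        (hre.comp (contDiff_pt 0).contDiffOn hm)).add (contDiffOn_const.mul
        (Complex.ofRealCLM.contDiff.comp_contDiffOn (him.comp (contDiff_pt 0).contDiffOn hm)))
    · have hx := pt_mem_region hu hζ 0
      have h1 := hasWirtinger_comp_pt (hasGrad_of_contDiffOn hR hre hx)
      have h2 := hasWirtinger_comp_pt (hasGrad_of_contDiffOn hR him hx)
      obtain ⟨-, -, h3, h4⟩ := h _ hx
      have h5 := (h1.add (h2.const_mul Complex.I)).congr_deriv (b' := 0) rfl (by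
        rw [h3, h4]
        push_cast
        linear_combination (pd 3 (fieldIm Λ Φ) (pt u 0 ζ) / 2 : ℂ) * Complex.I_sq)
      exact h5.hasDerivAt.differentiableAt.differentiableWithinAt
    · have hc : ∀ f : Pt → ℝ, ContDiffOn ℝ ∞ f (region I Ω) →
          (∀ y ∈ region I Ω, pd 1 f y = 0) → f (pt (uCoord x) 0 (zCoord x)) = f x := by
        intro f hf h0
        have := eq_of_pd_one_eq_zero (f := f) (u := uCoord x) (ζ := zCoord x)
          (fun v => (hf.contDiffAt (hR.mem_nhds (pt_mem_region hx.1 hx.2 v))).differentiableAt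
            (by simp)) (fun v => h0 _ (pt_mem_region hx.1 hx.2 v)) 0 (x 1)
        rwa [pt_coords] at this
      have hpx : (chartP Λ x : ℂ) ≠ 0 := by exact_mod_cast hp' x hx
      rw [nullComponent_eq (hp' x hx)]
      simp only [E]
      rw [hc _ hre fun y hy => (h y hy).1, hc _ him fun y hy => (h y hy).2.1]
      simp only [fieldRe, fieldIm]
      push_cast
      field_simp
      rw [mul_comm]
      exact (Complex.re_add_im (Φ x)).symm.trans (by ring)
  · rintro ⟨E, hE, hΦE⟩ x hx
    have heRe : ∀ y ∈ region I Ω, fieldRe Λ Φ y = chartH (fun u ζ => (E u ζ).re) y :=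
      fun y hy => fieldRe_eq (hp' y hy) (hΦE y hy)
    have heIm : ∀ y ∈ region I Ω, fieldIm Λ Φ y = chartH (fun u ζ => (E u ζ).im) y :=
      fun y hy => fieldIm_eq (hp' y hy) (hΦE y hy)
    have hd : ∀ {f g : Pt → ℝ}, ContDiffOn ℝ ∞ f (region I Ω) →
        (∀ y ∈ region I Ω, f y = g y) → f =ᶠ[nhds x] g ∧ DifferentiableAt ℝ g x := by
      intro f g hf hfg
      have e : f =ᶠ[nhds x] g := by
        filter_upwards [hR.mem_nhds hx] with y hy using hfg y hy
      exact ⟨e, ((hf.contDiffAt (hR.mem_nhds hx)).differentiableAt (by simp)).congr_of_eventuallyEq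
        e.symm⟩
    obtain ⟨e1, d1⟩ := hd hre heRe
    obtain ⟨e2, d2⟩ := hd him heIm
    refine ⟨by rw [pd_congr 1 e1, pd_one_chartH d1], by rw [pd_congr 1 e2, pd_one_chartH d2], ?_⟩
    have g1 := hasGrad_of_contDiffOn hR hre hx
    have g2 := hasGrad_of_contDiffOn hR him hx
    rw [← pt_coords x] at g1 g2
    have w1 := hasWirtinger_comp_pt g1
    have w2 := hasWirtinger_comp_pt g2
    rw [pt_coords] at w1 w2
    have w3 := HasWirtinger.of_hasDerivAt
      (((hE.2 _ hx.1).differentiableAt (hΩ.mem_nhds hx.2)).hasDerivAt)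
    have w4 := (w1.add (w2.const_mul Complex.I)).congr (ψ := E (uCoord x)) (by
      filter_upwards [hΩ.mem_nhds hx.2] with ζ hζ
      have hζx := pt_mem_region hx.1 hζ (x 1)
      rw [heRe _ hζx, heIm _ hζx, mul_comm Complex.I]
      exact (Complex.re_add_im _).symm)
    -- Holomorphy makes the ζ̄-derivative of E zero; its real and imaginary parts are the two
    -- Cauchy-Riemann equations.
    have hb := (w3.unique w4).2
    have hb1 := congrArg Complex.re hb
    have hb2 := congrArg Complex.im hb
    simp at hb1 hb2
    exact ⟨by linarith, by linarith⟩

end MaxwellSolutions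

/-! ### The wave profile -/

section Profile

variable {Λ : ℝ} {I : Set ℝ} {Ω : Set ℂ} {H : ℝ → ℂ → ℝ} {E A f : ℝ → ℂ → ℂ}

theorem IsHolomorphicProfile.hasDerivAt (hE : IsHolomorphicProfile I Ω E) (hΩ : IsOpen Ω)
    {u : ℝ} (hu : u ∈ I) {ζ : ℂ} (hζ : ζ ∈ Ω) : HasDerivAt (E u) (deriv (E u) ζ) ζ :=
  ((hE.2 u hu).differentiableAt (hΩ.mem_nhds hζ)).hasDerivAt

theorem hasWirtinger_generating {a φ : ℂ → ℂ} {a' φ' ζ : ℂ} (ha : HasDerivAt a a' ζ)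
    (hφ : HasDerivAt φ φ' ζ) :
    HasWirtinger (fun w => 2 * (a w * (starRingEnd ℂ) (a w)) + φ w + (starRingEnd ℂ) (φ w))
      (2 * (a' * (starRingEnd ℂ) (a ζ)) + φ') (2 * (a ζ * (starRingEnd ℂ) a')
        + (starRingEnd ℂ) φ') ζ := by
  have h1 := HasWirtinger.of_hasDerivAt ha
  have h2 := HasWirtinger.of_hasDerivAt hφ
  exact (((h1.mul h1.conj).const_mul 2).add h2 |>.add h2.conj).congr_deriv (by simp) (by simp)

theorem contDiffOn_dzeta_profile (hI : IsOpen I) (hΩ : IsOpen Ω) (hH : IsSmoothProfile I Ω H) :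
    ContDiffOn ℝ ∞ (fun p : ℝ × ℂ => dzeta (fun ζ => (H p.1 ζ : ℂ)) p.2) (I ×ˢ Ω) := by
  have hR := isOpen_region hI hΩ
  have hc := contDiffOn_chartH hH
  have hm : Set.MapsTo (fun p : ℝ × ℂ => pt p.1 0 p.2) (I ×ˢ Ω) (region I Ω) :=
    fun p hp => pt_mem_region hp.1 hp.2 0
  have h (i : Fin 4) : ContDiffOn ℝ ∞ (fun p : ℝ × ℂ => (pd i (chartH H) (pt p.1 0 p.2) : ℂ))
      (I ×ˢ Ω) := Complex.ofRealCLM.contDiff.comp_contDiffOn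
    ((contDiffOn_pd hR hc i).comp (contDiff_pt 0).contDiffOn hm)
  refine (contDiffOn_const.mul ((h 2).sub (contDiffOn_const.mul (h 3)))).congr fun p hp =>
    dzeta_profile hI hΩ hH (v := 0) hp.1 hp.2

theorem isConst_of_hasWirtinger_zero (hΩ : IsOpen Ω) (hΩc : IsPreconnected Ω) {k : ℂ → ℂ}
    (hk : ∀ ζ ∈ Ω, HasWirtinger k 0 0 ζ) {ζ ζ₀ : ℂ} (hζ : ζ ∈ Ω) (hζ₀ : ζ₀ ∈ Ω) : k ζ = k ζ₀ :=
  hΩ.is_const_of_deriv_eq_zero hΩc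
    (fun w hw => (hk w hw).hasDerivAt.differentiableAt.differentiableWithinAt)
    (fun w hw => (hk w hw).hasDerivAt.deriv) hζ hζ₀

/-- The profiles with `∂_ζ ∂_ζ̄ H = 2 |E|²` are the functions `2 |∫ E dζ|² + f + f̄`. -/
theorem laplacian_profile_iff (hI : IsOpen I) (hΩ : IsOpen Ω) (hΩc : IsSimplyConnected Ω)
    (hE : IsHolomorphicProfile I Ω E) (hA : IsZetaPrimitive I Ω E A)
    (hH : IsSmoothProfile I Ω H) :
    (∀ x ∈ region I Ω, pd 2 (pd 2 (chartH H)) x + pd 3 (pd 3 (chartH H)) x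
      = 8 * ‖E (uCoord x) (zCoord x)‖ ^ 2) ↔
    ∃ f : ℝ → ℂ → ℂ, IsHolomorphicProfile I Ω f ∧ ∀ u ∈ I, ∀ ζ ∈ Ω,
      (H u ζ : ℂ) = 2 * (‖A u ζ‖ : ℂ) ^ 2 + f u ζ + (starRingEnd ℂ) (f u ζ) := by
  constructor
  · intro h
    -- In the desired formula H_ζ = 2EĀ + f_ζ, so `D` is the candidate for f_ζ. Its ζ̄-derivative is
    -- a quarter of the Laplacian of H minus 2|E|², which is zero.
    let D : ℝ → ℂ → ℂ := fun u ζ =>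
      dzeta (fun ζ => (H u ζ : ℂ)) ζ - 2 * (E u ζ * (starRingEnd ℂ) (A u ζ))
    have hconj : ContDiff ℝ ∞ (fun z : ℂ => (starRingEnd ℂ) z) := Complex.conjCLE.contDiff
    have hD : IsHolomorphicProfile I Ω D := by
      refine ⟨(contDiffOn_dzeta_profile hI hΩ hH).sub (contDiffOn_const.mul
        (hE.1.mul (hconj.comp_contDiffOn hA.1.1))), fun u hu ζ hζ => ?_⟩
      have hx := pt_mem_region hu hζ 0
      have h1 := hasWirtinger_dzeta_profile hI hΩ hH hx
      have h2 := HasWirtinger.of_hasDerivAt (hE.hasDerivAt hΩ hu hζ)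
      have h3 := (HasWirtinger.of_hasDerivAt (hA.2 u hu ζ hζ)).conj
      have h4 := h1.sub ((h2.mul h3).const_mul 2)
      have hl := congrArg (fun t : ℝ => (t : ℂ)) (h _ hx)
      push_cast at hl
      rw [uCoord_pt, zCoord_pt, ← Complex.mul_conj'] at hl
      refine (h4.congr_deriv (b' := 0) rfl ?_).hasDerivAt.differentiableAt.differentiableWithinAt
      linear_combination (1 / 4 : ℂ) * hl
    obtain ⟨g, hg⟩ := exists_isZetaPrimitive hI hΩ hΩc hD
    let k : ℝ → ℂ → ℂ := fun u ζ =>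
      H u ζ - (2 * (A u ζ * (starRingEnd ℂ) (A u ζ)) + g u ζ + (starRingEnd ℂ) (g u ζ))
    have hk : ∀ u ∈ I, ∀ ζ ∈ Ω, HasWirtinger (k u) 0 0 ζ := by
      intro u hu ζ hζ
      refine ((hasWirtinger_profile' hI hΩ hH hu hζ).sub
        (hasWirtinger_generating (hA.2 u hu ζ hζ) (hg.2 u hu ζ hζ))).congr_deriv ?_ ?_
      · simp only [D]; ring
      · have h2 : (starRingEnd ℂ) 2 = 2 := Complex.conj_ofNat 2
        simp only [D, map_sub, map_mul, Complex.conj_conj, h2]; ring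
    have hpc : IsPreconnected Ω := by
      have := hΩc.simplyConnectedSpace
      exact isPreconnected_iff_preconnectedSpace.2 inferInstance
    obtain ⟨ζ₀, hζ₀⟩ := hΩc.nonempty
    -- The remainder `k` is real and constant in ζ; half of it goes into f and the other half arises
    -- from the conjugate. Evaluation at the fixed ζ₀ shows its smoothness in u.
    refine ⟨fun u ζ => g u ζ + k u ζ₀ / 2, ⟨hg.1.1.add ?_, fun u hu =>
      (hg.1.2 u hu).add_const _⟩, fun u hu ζ hζ => ?_⟩
    · have hm : Set.MapsTo (fun p : ℝ × ℂ => (p.1, ζ₀)) (I ×ˢ Ω) (I ×ˢ Ω) :=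
        fun p hp => ⟨hp.1, hζ₀⟩
      have hc : ContDiff ℝ ∞ (fun p : ℝ × ℂ => (p.1, ζ₀)) := by fun_prop
      have hk1 : ContDiffOn ℝ ∞ (fun p : ℝ × ℂ => k p.1 p.2) (I ×ˢ Ω) :=
        (Complex.ofRealCLM.contDiff.comp_contDiffOn hH).sub
          (((contDiffOn_const.mul (hA.1.1.mul (hconj.comp_contDiffOn hA.1.1))).add hg.1.1).add
            (hconj.comp_contDiffOn hg.1.1))
      exact (hk1.comp hc.contDiffOn hm).div_const 2
    · have h1 : k u ζ = k u ζ₀ := isConst_of_hasWirtinger_zero hΩ hpc (hk u hu) hζ hζ₀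
      have hreal : ∀ w, (starRingEnd ℂ) (k u w) = k u w := by
        intro w
        have h2 : (starRingEnd ℂ) 2 = 2 := Complex.conj_ofNat 2
        simp only [k, map_sub, map_add, map_mul, Complex.conj_ofReal, Complex.conj_conj, h2]
        ring
      have h2 : (starRingEnd ℂ) 2 = 2 := Complex.conj_ofNat 2
      have h3 : k u ζ = H u ζ - (2 * (A u ζ * (starRingEnd ℂ) (A u ζ)) + g u ζ
        + (starRingEnd ℂ) (g u ζ)) := rfl
      rw [map_add, map_div₀, hreal, h2, ← Complex.mul_conj']
      linear_combination h1 - h3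
  · rintro ⟨f, hf, hHf⟩ x hx
    have hgen : ∀ ζ ∈ Ω, (H (uCoord x) ζ : ℂ) = 2 * (A (uCoord x) ζ *
        (starRingEnd ℂ) (A (uCoord x) ζ)) + f (uCoord x) ζ + (starRingEnd ℂ) (f (uCoord x) ζ) := by
      intro ζ hζ
      rw [hHf _ hx.1 ζ hζ, ← Complex.mul_conj']
    have e : ∀ ζ ∈ Ω, dzeta (fun ζ => (H (uCoord x) ζ : ℂ)) ζ =
        2 * (E (uCoord x) ζ * (starRingEnd ℂ) (A (uCoord x) ζ)) + deriv (f (uCoord x)) ζ := by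
      intro ζ hζ
      refine ((hasWirtinger_generating (hA.2 _ hx.1 ζ hζ)
        (hf.hasDerivAt hΩ hx.1 hζ)).congr ?_).dzeta_eq
      filter_upwards [hΩ.mem_nhds hζ] with w hw using hgen w hw
    have hE' := HasWirtinger.of_hasDerivAt (hE.hasDerivAt hΩ hx.1 hx.2)
    have hA' := (HasWirtinger.of_hasDerivAt (hA.2 _ hx.1 _ hx.2)).conj
    have hf' := HasWirtinger.of_hasDerivAt
      (((hf.2 _ hx.1).deriv hΩ).differentiableAt (hΩ.mem_nhds hx.2)).hasDerivAt
    have h1 := (((hE'.mul hA').const_mul 2).add hf').congr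
      (ψ := dzeta fun ζ => (H (uCoord x) ζ : ℂ)) (by
        filter_upwards [hΩ.mem_nhds hx.2] with w hw using e w hw)
    have h2 := ((hasWirtinger_dzeta_profile hI hΩ hH hx).unique h1).2
    have h3 : ((pd 2 (pd 2 (chartH H)) x + pd 3 (pd 3 (chartH H)) x : ℝ) : ℂ)
        = ((8 * ‖E (uCoord x) (zCoord x)‖ ^ 2 : ℝ) : ℂ) := by
      push_cast
      rw [← Complex.mul_conj']
      linear_combination 4 * h2
    exact_mod_cast h3

/-- The Einstein equations for the null field of `E`, in terms of the profile. -/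
theorem einstein_iff_laplacian {Φ : Pt → ℂ} (hI : IsOpen I) (hΩ : IsOpen Ω)
    (hp : ∀ ζ ∈ Ω, nariaiP Λ ζ ≠ 0) (hH : IsSmoothProfile I Ω H)
    (hΦ : ∀ x ∈ region I Ω, Φ x = nullComponent Λ E x) :
    (∀ x ∈ region I Ω, ∀ a b, ricci (nariaiWave Λ H) a b x
      - (1 / 2) * scalarCurvature (nariaiWave Λ H) x * nariaiWave Λ H x a b
      + Λ * nariaiWave Λ H x a b
        = maxwellStress (nariaiWave Λ H) (nariaiNullField Λ H Φ) a b x) ↔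
    ∀ x ∈ region I Ω, pd 2 (pd 2 (chartH H)) x + pd 3 (pd 3 (chartH H)) x
      = 8 * ‖E (uCoord x) (zCoord x)‖ ^ 2 := by
  rw [einstein_iff (isOpen_region hI hΩ) (fun x hx => hp _ hx.2) (contDiffOn_chartH hH)]
  refine forall₂_congr fun x hx => ?_
  rw [fieldRe_eq (hp _ hx.2) (hΦ x hx), fieldIm_eq (hp _ hx.2) (hΦ x hx), ← Complex.normSq_eq_norm_sq,
    Complex.normSq_apply]
  ring_nf

theorem contDiffOn_nullComponent (hp : ∀ ζ ∈ Ω, nariaiP Λ ζ ≠ 0)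
    (hE : IsHolomorphicProfile I Ω E) : ContDiffOn ℝ ∞ (nullComponent Λ E) (region I Ω) := by
  have h1 : ContDiffOn ℝ ∞ (fun x => E (uCoord x) (zCoord x)) (region I Ω) :=
    hE.1.comp (f := fun x : Pt => (uCoord x, zCoord x))
      (contDiff_uCoord.prodMk contDiff_zCoord).contDiffOn fun _ hx => ⟨hx.1, hx.2⟩
  exact (h1.mul (Complex.ofRealCLM.contDiff.comp (contDiff_chartP Λ)).contDiffOn).congr
    fun x hx => nullComponent_eq (hp _ hx.2)

end Profile

/-! ### The gravitational wave accompanying an electromagnetic wave -/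

section Accompanying

/-- Holomorphic coefficients are constants for ∂_ζ̄, so differentiating twice in ζ̄ isolates 2c;
then b and a follow in turn. -/
theorem eq_zero_of_quadratic_conj {B : Set ℂ} (hB : IsOpen B) {a b c a' b' c' : ℂ → ℂ}
    (ha : ∀ z ∈ B, HasDerivAt a (a' z) z) (hb : ∀ z ∈ B, HasDerivAt b (b' z) z)
    (hc : ∀ z ∈ B, HasDerivAt c (c' z) z)
    (h : ∀ z ∈ B, a z + b z * (starRingEnd ℂ) z + c z * ((starRingEnd ℂ) z * (starRingEnd ℂ) z) = 0) :
    ∀ z ∈ B, a z = 0 ∧ b z = 0 ∧ c z = 0 := by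
  have h1 : ∀ z ∈ B, b z + 2 * (c z * (starRingEnd ℂ) z) = 0 := by
    intro z hz
    have hz' := (HasWirtinger.id z).conj
    have := ((((HasWirtinger.of_hasDerivAt (ha z hz)).add
      ((HasWirtinger.of_hasDerivAt (hb z hz)).mul hz')).add
      ((HasWirtinger.of_hasDerivAt (hc z hz)).mul (hz'.mul hz'))).eq_zero
      (by filter_upwards [hB.mem_nhds hz] with w hw using h w hw)).2
    simp only [map_one] at this
    linear_combination this
  have h2 : ∀ z ∈ B, c z = 0 := by
    intro z hz
    have hz' := (HasWirtinger.id z).conj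
    have := (((HasWirtinger.of_hasDerivAt (hb z hz)).add
      (((HasWirtinger.of_hasDerivAt (hc z hz)).mul hz').const_mul 2)).eq_zero
      (by filter_upwards [hB.mem_nhds hz] with w hw using h1 w hw)).2
    simp only [map_one] at this
    linear_combination this / 2
  intro z hz
  have hc0 := h2 z hz
  have hb0 : b z = 0 := by linear_combination h1 z hz - 2 * (starRingEnd ℂ) z * hc0
  refine ⟨?_, hb0, hc0⟩
  linear_combination h z hz - (starRingEnd ℂ) z * hb0
    - (starRingEnd ℂ) z * (starRingEnd ℂ) z * hc0

/-- If `∂_ζ² (P (2 |a|² + φ + φ̄)) = 0` for holomorphic `a` and `φ`, then `a' = 0`. -/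
theorem deriv_eq_zero_of_generating {Λ : ℝ} (hΛ : Λ ≠ 0) {B : Set ℂ} (hB : IsOpen B)
    {a a₁ a₂ a₃ a₄ φ₁ φ₂ φ₃ : ℂ → ℂ}
    (ha : ∀ z ∈ B, HasDerivAt a (a₁ z) z) (ha₁ : ∀ z ∈ B, HasDerivAt a₁ (a₂ z) z)
    (ha₂ : ∀ z ∈ B, HasDerivAt a₂ (a₃ z) z) (ha₃ : ∀ z ∈ B, HasDerivAt a₃ (a₄ z) z)
    (hφ₁ : ∀ z ∈ B, HasDerivAt φ₁ (φ₂ z) z) (hφ₂ : ∀ z ∈ B, HasDerivAt φ₂ (φ₃ z) z)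
    (h : ∀ z ∈ B, Λ * (starRingEnd ℂ) z * (2 * (a₁ z * (starRingEnd ℂ) (a z)) + φ₁ z)
      + nariaiP Λ z * (2 * (a₂ z * (starRingEnd ℂ) (a z)) + φ₂ z) = 0) :
    ∀ z ∈ B, a₁ z = 0 := by
  by_contra hne
  push Not at hne
  obtain ⟨z₁, hz₁, hz₁0⟩ := hne
  -- derivatives of the equation
  have hW := fun z hz => (((((HasWirtinger.id z).conj.const_mul (Λ : ℂ)).mul
    ((((HasWirtinger.of_hasDerivAt (ha₁ z hz)).mul
      (HasWirtinger.of_hasDerivAt (ha z hz)).conj).const_mul 2).add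
      (HasWirtinger.of_hasDerivAt (hφ₁ z hz)))).add ((hasWirtinger_nariaiP Λ z).mul
    ((((HasWirtinger.of_hasDerivAt (ha₂ z hz)).mul
      (HasWirtinger.of_hasDerivAt (ha z hz)).conj).const_mul 2).add
      (HasWirtinger.of_hasDerivAt (hφ₂ z hz))))).eq_zero
      (by filter_upwards [hB.mem_nhds hz] with w hw using h w hw))
  have hP : ∀ z : ℂ, (nariaiP Λ z : ℂ) = 1 + Λ / 2 * (z * (starRingEnd ℂ) z) := by
    intro z
    rw [Complex.mul_conj]
    simp [nariaiP]
  have e1 : ∀ z ∈ B, Λ * (2 * (a₁ z * (starRingEnd ℂ) (a z)) + φ₁ z)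
      + 2 * Λ * ((starRingEnd ℂ) z * (a₁ z * (starRingEnd ℂ) (a₁ z)))
      + Λ / 2 * z * (2 * (a₂ z * (starRingEnd ℂ) (a z)) + φ₂ z)
      + 2 * nariaiP Λ z * (a₂ z * (starRingEnd ℂ) (a₁ z)) = 0 := by
    intro z hz
    have := (hW z hz).2
    simp only [map_one] at this
    linear_combination this
  have e0z : ∀ z ∈ B, Λ * (starRingEnd ℂ) z * (2 * (a₂ z * (starRingEnd ℂ) (a z)) + φ₂ z)
      + Λ / 2 * (starRingEnd ℂ) z * (2 * (a₂ z * (starRingEnd ℂ) (a z)) + φ₂ z)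
      + nariaiP Λ z * (2 * (a₃ z * (starRingEnd ℂ) (a z)) + φ₃ z) = 0 := by
    intro z hz
    have := (hW z hz).1
    simp only [map_zero] at this
    linear_combination this
  have e1z : ∀ z ∈ B, Λ * (2 * (a₂ z * (starRingEnd ℂ) (a z)) + φ₂ z)
      + 2 * Λ * ((starRingEnd ℂ) z * (a₂ z * (starRingEnd ℂ) (a₁ z)))
      + Λ / 2 * (2 * (a₂ z * (starRingEnd ℂ) (a z)) + φ₂ z)
      + Λ / 2 * z * (2 * (a₃ z * (starRingEnd ℂ) (a z)) + φ₃ z)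
      + Λ * (starRingEnd ℂ) z * (a₂ z * (starRingEnd ℂ) (a₁ z))
      + 2 * nariaiP Λ z * (a₃ z * (starRingEnd ℂ) (a₁ z)) = 0 := by
    intro z hz
    have hz' := HasWirtinger.id z
    have w (g g' : ℂ → ℂ) (hg : ∀ z ∈ B, HasDerivAt g (g' z) z) :=
      HasWirtinger.of_hasDerivAt (hg z hz)
    have hac := (w _ _ ha).conj
    have hac₁ := (w _ _ ha₁).conj
    have := ((((((((w _ _ ha₁).mul hac).const_mul 2).add (w _ _ hφ₁)).const_mul (Λ : ℂ)).add
      ((hz'.conj.mul ((w _ _ ha₁).mul hac₁)).const_mul (2 * Λ : ℂ))).add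
      ((hz'.const_mul (Λ / 2 : ℂ)).mul
        ((((w _ _ ha₂).mul hac).const_mul 2).add (w _ _ hφ₂)))).add
      (((hasWirtinger_nariaiP Λ z).const_mul 2).mul ((w _ _ ha₂).mul hac₁))).eq_zero
      (by filter_upwards [hB.mem_nhds hz] with w hw using e1 w hw)
    have := this.1
    simp only [map_zero] at this
    linear_combination this
  -- Write W for the left side of the hypothesis. The combination P_ζ̄ W_ζ - P W_ζζ̄ + (3/2)Λ(W - ζ̄
  -- W_ζ̄) kills every term in ā and φ: the first two summands cancel the third-order terms, and P -
  -- Λζζ̄/2 = 1 cancels the rest. The bracket that remains is (P³a₁)_ζζ / P.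
  have key : ∀ z ∈ B, (starRingEnd ℂ) (a₁ z) * (nariaiP Λ z ^ 2 * a₃ z
      + 3 * Λ * (starRingEnd ℂ) z * nariaiP Λ z * a₂ z
      + 3 / 2 * Λ ^ 2 * ((starRingEnd ℂ) z) ^ 2 * a₁ z) = 0 := by
    intro z hz
    have h0 := h z hz
    have h1 := e1 z hz
    have h2 := e0z z hz
    have h3 := e1z z hz
    rw [hP] at h0 h1 h2 h3 ⊢
    linear_combination (-1 / 2 : ℂ) * ((Λ / 2 * z) * h2
      - (1 + Λ / 2 * (z * (starRingEnd ℂ) z)) * h3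
      + 3 / 2 * Λ * (h0 - (starRingEnd ℂ) z * h1))
  -- near `z₁` the bracket vanishes, and it is quadratic in the conjugate variable
  have hcont : ContinuousOn a₁ B := fun z hz => (ha₁ z hz).continuousAt.continuousWithinAt
  let B' : Set ℂ := B ∩ a₁ ⁻¹' {0}ᶜ
  have hB' : IsOpen B' := hcont.isOpen_inter_preimage hB isOpen_compl_singleton
  have hid : ∀ z : ℂ, HasDerivAt (fun w : ℂ => w) 1 z := fun z => hasDerivAt_id z
  -- The coefficients come from expanding P = 1 + Λζζ̄/2 in powers of ζ̄.
  have hquad := eq_zero_of_quadratic_conj hB' (a := a₃)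
    (b := fun z => Λ * (z * a₃ z) + 3 * Λ * a₂ z)
    (c := fun z => Λ ^ 2 / 4 * (z * z * a₃ z) + 3 / 2 * Λ ^ 2 * (z * a₂ z) + 3 / 2 * Λ ^ 2 * a₁ z)
    (fun z hz => ha₃ z hz.1)
    (fun z hz => (((hid z).mul (ha₃ z hz.1)).const_mul (Λ : ℂ)).add
      ((ha₂ z hz.1).const_mul (3 * Λ : ℂ)))
    (fun z hz => (((((hid z).mul (hid z)).mul (ha₃ z hz.1)).const_mul (Λ ^ 2 / 4 : ℂ)).add
      (((hid z).mul (ha₂ z hz.1)).const_mul (3 / 2 * Λ ^ 2 : ℂ))).add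
      ((ha₁ z hz.1).const_mul (3 / 2 * Λ ^ 2 : ℂ)))
    (fun z hz => by
      have hne : (starRingEnd ℂ) (a₁ z) ≠ 0 := (map_ne_zero _).2 hz.2
      have := (mul_eq_zero.1 (key z hz.1)).resolve_left hne
      rw [hP] at this
      linear_combination this)
  obtain ⟨q1, q2, q3⟩ := hquad z₁ ⟨hz₁, hz₁0⟩
  have hΛ' : (Λ : ℂ) ≠ 0 := by exact_mod_cast hΛ
  have r2 : a₂ z₁ = 0 := by
    have : 3 * (Λ : ℂ) * a₂ z₁ = 0 := by linear_combination q2 - Λ * z₁ * q1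
    simpa [hΛ'] using this
  have r1 : a₁ z₁ = 0 := by
    have : 3 / 2 * (Λ : ℂ) ^ 2 * a₁ z₁ = 0 := by
      linear_combination q3 - Λ ^ 2 / 4 * (z₁ * z₁) * q1 - 3 / 2 * Λ ^ 2 * z₁ * r2
    simpa [hΛ'] using this
  exact hz₁0 r1

end Accompanying

/-! ### The gravitational wave -/

section GravitationalWave

variable {Λ : ℝ} {I : Set ℝ} {Ω : Set ℂ} {H : ℝ → ℂ → ℝ} {E : ℝ → ℂ → ℂ} {u : ℝ}

theorem psi4_eq_dzeta_dzeta (hI : IsOpen I) (hΩ : IsOpen Ω) (hp : ∀ ζ ∈ Ω, nariaiP Λ ζ ≠ 0)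
    (hH : IsSmoothProfile I Ω H) {x : Pt} (hx : x ∈ region I Ω) :
    Psi4 (nariaiWave Λ H) x (naturalTetrad Λ H x)
      = (1 / 2) * dzeta (dzeta fun ζ => (nariaiP Λ ζ : ℂ) * (H (uCoord x) ζ : ℂ)) (zCoord x)
        * (nariaiP Λ (zCoord x) : ℂ) := by
  have hp' : (chartP Λ x : ℂ) ≠ 0 := by exact_mod_cast hp _ hx.2
  rw [psi4_naturalTetrad (isOpen_region hI hΩ) (fun y hy => hp _ hy.2) (contDiffOn_chartH hH) hx,
    dzeta_dzeta_mul_profile hI hΩ hH hx, zCoord_eq]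
  rw [← zCoord_eq, show nariaiP Λ (zCoord x) = chartP Λ x from rfl]
  simp only [zCoord_eq, map_add, map_mul, Complex.conj_ofReal, Complex.conj_I]
  field_simp
  linear_combination (-4 * Λ * x 3 * pd 3 (chartH H) x : ℂ) * Complex.I_sq

theorem continuous_pt (u v : ℝ) : Continuous fun ζ : ℂ => pt u v ζ :=
  (contDiff_pt v).continuous.comp (Continuous.prodMk_right u)

theorem continuousOn_wavefront {f : Pt → ℝ} (hf : ContDiffOn ℝ ∞ f (region I Ω)) (hu : u ∈ I) :
      ContinuousOn (fun ζ : ℂ => (f (pt u 0 ζ) : ℂ)) Ω :=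
    Complex.continuous_ofReal.comp_continuousOn (hf.continuousOn.comp (continuous_pt u 0).continuousOn
      fun _ hζ => pt_mem_region hu hζ 0)

theorem continuousOn_dzeta_dzeta (hI : IsOpen I) (hΩ : IsOpen Ω) (hH : IsSmoothProfile I Ω H)
    (hu : u ∈ I) :
    ContinuousOn (dzeta (dzeta fun ζ => (nariaiP Λ ζ : ℂ) * (H u ζ : ℂ))) Ω := by
  have hR := isOpen_region hI hΩ
  have hc := contDiffOn_chartH hH
  have h1 (i : Fin 4) := continuousOn_wavefront (contDiffOn_pd hR hc i) hu
  have h2 (i j : Fin 4) := continuousOn_wavefront (contDiffOn_pd hR (contDiffOn_pd hR hc i) j) hu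
  have hP := continuousOn_wavefront (I := I) (Ω := Ω) (contDiff_chartP Λ).contDiffOn hu
  have hconj : ContinuousOn (fun z : ℂ => (starRingEnd ℂ) z) Ω := Complex.continuous_conj.continuousOn
  have e : ∀ ζ ∈ Ω, _ := fun ζ hζ =>
    dzeta_dzeta_mul_profile (Λ := Λ) hI hΩ hH (pt_mem_region hu hζ 0)
  simp only [uCoord_pt, zCoord_pt] at e
  refine ContinuousOn.congr ?_ e
  have k1 := ((continuousOn_const (c := (Λ : ℂ))).mul hconj).mul
    ((continuousOn_const (c := (1 / 2 : ℂ))).mul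
    ((h1 2).sub ((continuousOn_const (c := Complex.I)).mul (h1 3))))
  have k2 := (hP.mul ((continuousOn_const (c := (1 / 4 : ℂ))).mul
      (((h2 2 2).sub (h2 3 3)).sub ((continuousOn_const (c := 2 * Complex.I)).mul (h2 3 2)))))
  exact k1.add k2

/-- If the profile of an Einstein-Maxwell wave satisfies `∂_ζ² (P H) = 0` on an open part of a
wave-front, then its electromagnetic field vanishes there. -/
theorem eq_zero_of_dzeta_dzeta_eq_zero (hΛ : Λ ≠ 0) (hΩ : IsOpen Ω)
    {A f : ℝ → ℂ → ℂ} (hE : IsHolomorphicProfile I Ω E) (hA : IsZetaPrimitive I Ω E A)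
    (hf : IsHolomorphicProfile I Ω f) (hu : u ∈ I)
    (hHf : ∀ ζ ∈ Ω, (H u ζ : ℂ) = 2 * (‖A u ζ‖ : ℂ) ^ 2 + f u ζ + (starRingEnd ℂ) (f u ζ))
    {B : Set ℂ} (hB : IsOpen B) (hBΩ : B ⊆ Ω)
    (h0 : ∀ ζ ∈ B, dzeta (dzeta fun ζ => (nariaiP Λ ζ : ℂ) * (H u ζ : ℂ)) ζ = 0) :
    ∀ ζ ∈ B, E u ζ = 0 := by
  have hder {g : ℂ → ℂ} (hg : DifferentiableOn ℂ g Ω) : ∀ z ∈ Ω, HasDerivAt g (deriv g z) z :=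
    fun z hz => (hg.differentiableAt (hΩ.mem_nhds hz)).hasDerivAt
  have hE0 := hE.2 u hu
  have hE1 := hE0.deriv hΩ
  have hE2 := hE1.deriv hΩ
  have hf0 := hf.2 u hu
  have hf1 := hf0.deriv hΩ
  have hf2 := hf1.deriv hΩ
  refine deriv_eq_zero_of_generating hΛ hB (fun z hz => hA.2 u hu z (hBΩ hz))
    (fun z hz => hder hE0 z (hBΩ hz)) (fun z hz => hder hE1 z (hBΩ hz))
    (fun z hz => hder hE2 z (hBΩ hz)) (fun z hz => hder hf1 z (hBΩ hz))
    (fun z hz => hder hf2 z (hBΩ hz)) fun z hz => ?_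
  have hgen : ∀ ζ ∈ Ω, (H u ζ : ℂ) = 2 * (A u ζ * (starRingEnd ℂ) (A u ζ)) + f u ζ
      + (starRingEnd ℂ) (f u ζ) := fun ζ hζ => by rw [hHf ζ hζ, ← Complex.mul_conj']
  have hW : ∀ ζ ∈ Ω, HasWirtinger (fun ζ => (H u ζ : ℂ)) _ _ ζ := fun ζ hζ =>
    (hasWirtinger_generating (hA.2 u hu ζ hζ) (hder hf0 ζ hζ)).congr
      (by filter_upwards [hΩ.mem_nhds hζ] with w hw using hgen w hw)
  have e : ∀ ζ ∈ Ω, dzeta (fun ζ => (nariaiP Λ ζ : ℂ) * (H u ζ : ℂ)) ζ = _ := fun ζ hζ =>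
    ((hasWirtinger_nariaiP Λ ζ).mul (hW ζ hζ)).dzeta_eq
  have hz' := hBΩ hz
  have hEA := ((HasWirtinger.of_hasDerivAt (hder hE0 z hz')).mul
    (HasWirtinger.of_hasDerivAt (hA.2 u hu z hz')).conj).const_mul 2
  have h1 := ((((HasWirtinger.id z).conj.const_mul (Λ / 2 : ℂ)).mul (hW z hz')).add
    ((hasWirtinger_nariaiP Λ z).mul
      (hEA.add (HasWirtinger.of_hasDerivAt (hder hf1 z hz'))))).congr
    (ψ := dzeta fun ζ => (nariaiP Λ ζ : ℂ) * (H u ζ : ℂ))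
    (by filter_upwards [hΩ.mem_nhds hz'] with w hw using e w hw)
  have h2 := h1.dzeta_eq.symm.trans (h0 z hz)
  simp only [map_zero] at h2
  linear_combination h2

/-- Openness is continuity of (PH)_ζζ. If the set missed an open part of Ω, then E would vanish
there, and by the identity theorem on the connected Ω it would vanish on the whole front. -/
theorem isOpen_and_dense_gravitational_wave (hΛ : Λ ≠ 0) (hI : IsOpen I) (hΩ : IsOpen Ω)
    (hΩc : IsSimplyConnected Ω) (hH : IsSmoothProfile I Ω H)
    {A f : ℝ → ℂ → ℂ} (hE : IsHolomorphicProfile I Ω E) (hA : IsZetaPrimitive I Ω E A)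
    (hf : IsHolomorphicProfile I Ω f) (hu : u ∈ I)
    (hHf : ∀ ζ ∈ Ω, (H u ζ : ℂ) = 2 * (‖A u ζ‖ : ℂ) ^ 2 + f u ζ + (starRingEnd ℂ) (f u ζ))
    (hne : ∃ ζ ∈ Ω, E u ζ ≠ 0) :
    IsOpen {ζ ∈ Ω | dzeta (dzeta fun ζ => (nariaiP Λ ζ : ℂ) * (H u ζ : ℂ)) ζ ≠ 0} ∧
    Ω ⊆ closure {ζ ∈ Ω | dzeta (dzeta fun ζ => (nariaiP Λ ζ : ℂ) * (H u ζ : ℂ)) ζ ≠ 0} := by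
  refine ⟨(continuousOn_dzeta_dzeta hI hΩ hH hu).isOpen_inter_preimage hΩ isOpen_compl_singleton,
    fun ζ₁ hζ₁ => ?_⟩
  by_contra hcl
  obtain ⟨ζ₂, hζ₂, hne⟩ := hne
  set W := {ζ ∈ Ω | dzeta (dzeta fun ζ => (nariaiP Λ ζ : ℂ) * (H u ζ : ℂ)) ζ ≠ 0} with hW
  have hB : IsOpen (Ω ∩ (closure W)ᶜ) := hΩ.inter isClosed_closure.isOpen_compl
  have hzero := eq_zero_of_dzeta_dzeta_eq_zero hΛ hΩ hE hA hf hu hHf hB Set.inter_subset_left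
    fun ζ hζ => by
      by_contra h
      exact hζ.2 (subset_closure ⟨hζ.1, h⟩)
  have hpc : IsPreconnected Ω := by
    have := hΩc.simplyConnectedSpace
    exact isPreconnected_iff_preconnectedSpace.2 inferInstance
  have hana := (hE.2 u hu).analyticOnNhd hΩ
  have hev : E u =ᶠ[nhds ζ₁] 0 := by
    filter_upwards [hB.mem_nhds ⟨hζ₁, hcl⟩] with w hw using hzero w hw
  exact hne (hana.eqOn_zero_of_preconnected_of_eventuallyEq_zero hpc hζ₁ hev hζ₂)

end GravitationalWave

end KundtWave

end
-- Assembly of the four statements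
open KundtWave in
theorem mainTheorem3 (Λ : ℝ) (hΛ : Λ ≠ 0)
    (I : Set ℝ) (hI : IsOpen I)
    (Ω : Set ℂ) (hΩ : IsOpen Ω) (hΩc : IsSimplyConnected Ω)
    (hP : ∀ ζ ∈ Ω, nariaiP Λ ζ ≠ 0) :
    -- the Maxwell equations: a null field solves them iff it is `E₂ P³ / Q²`
    (∀ (H : ℝ → ℂ → ℝ) (Φ₂ : Pt → ℂ), IsSmoothProfile I Ω H →
      ContDiffOn ℝ ∞ Φ₂ (region I Ω) →
      (IsMaxwellField (nariaiWave Λ H) (nariaiNullField Λ H Φ₂) (region I Ω) ↔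
        ∃ E₂ : ℝ → ℂ → ℂ, IsHolomorphicProfile I Ω E₂ ∧
          ∀ x ∈ region I Ω, Φ₂ x = nullComponent Λ E₂ x)) ∧
    -- the Einstein-Maxwell equations: the general solution for the profile `H`
    (∀ E₂ : ℝ → ℂ → ℂ, IsHolomorphicProfile I Ω E₂ →
      (∃ A : ℝ → ℂ → ℂ, IsZetaPrimitive I Ω E₂ A) ∧
      ∀ A : ℝ → ℂ → ℂ, IsZetaPrimitive I Ω E₂ A →
        ∀ H : ℝ → ℂ → ℝ, IsSmoothProfile I Ω H →
          (IsEinsteinMaxwell Λ (nariaiWave Λ H) (nariaiNullField Λ H (nullComponent Λ E₂))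
              (region I Ω) ↔
            ∃ f : ℝ → ℂ → ℂ, IsHolomorphicProfile I Ω f ∧
              ∀ u ∈ I, ∀ ζ ∈ Ω,
                (H u ζ : ℂ) = 2 * (‖A u ζ‖ : ℂ) ^ 2 + f u ζ + (starRingEnd ℂ) (f u ζ))) ∧
    -- the Weyl scalars and the Petrov type
    (∀ H : ℝ → ℂ → ℝ, IsSmoothProfile I Ω H → ∀ x ∈ region I Ω,
      IsNullTetrad (nariaiWave Λ H) x (naturalTetrad Λ H x) ∧
      Psi0 (nariaiWave Λ H) x (naturalTetrad Λ H x) = 0 ∧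
      Psi1 (nariaiWave Λ H) x (naturalTetrad Λ H x) = 0 ∧
      Psi2 (nariaiWave Λ H) x (naturalTetrad Λ H x) = -(Λ : ℂ) / 3 ∧
      Psi3 (nariaiWave Λ H) x (naturalTetrad Λ H x) = 0 ∧
      Psi4 (nariaiWave Λ H) x (naturalTetrad Λ H x)
        = (1 / 2) * dzeta (dzeta fun ζ => (nariaiP Λ ζ : ℂ) * (H (uCoord x) ζ : ℂ)) (zCoord x)
          * (nariaiP Λ (zCoord x) : ℂ) ^ 4 / (nariaiQ Λ (zCoord x) : ℂ) ^ 3 ∧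
      (Psi4 (nariaiWave Λ H) x (naturalTetrad Λ H x) ≠ 0 → IsPetrovTypeII (nariaiWave Λ H) x)) ∧
    -- an electromagnetic wave is necessarily accompanied by a gravitational wave
    (∀ (H : ℝ → ℂ → ℝ) (Φ₂ : Pt → ℂ), IsSmoothProfile I Ω H →
      ContDiffOn ℝ ∞ Φ₂ (region I Ω) →
      IsEinsteinMaxwell Λ (nariaiWave Λ H) (nariaiNullField Λ H Φ₂) (region I Ω) →
      ∀ u ∈ I, (∃ v : ℝ, ∃ ζ ∈ Ω, Φ₂ (pt u v ζ) ≠ 0) →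
        let W : Set ℂ := {ζ ∈ Ω | ∀ v : ℝ,
          Psi4 (nariaiWave Λ H) (pt u v ζ) (naturalTetrad Λ H (pt u v ζ)) ≠ 0 ∧
          IsPetrovTypeII (nariaiWave Λ H) (pt u v ζ)}
        IsOpen W ∧ Ω ⊆ closure W) := by
  have hR := isOpen_region hI hΩ
  have hp : ∀ x ∈ region I Ω, chartP Λ x ≠ 0 := fun x hx => hP _ hx.2
  refine ⟨fun H Φ₂ hH hΦ => isMaxwellField_iff_exists hI hΩ hP hH hΦ, fun E₂ hE =>
    ⟨exists_isZetaPrimitive hI hΩ hΩc hE, fun A hA H hH => ?_⟩, fun H hH x hx => ?_,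
    fun H Φ₂ hH hΦ hEM u hu hne => ?_⟩
  · rw [← laplacian_profile_iff hI hΩ hΩc hE hA hH,
      ← einstein_iff_laplacian hI hΩ hP hH (fun x _ => rfl)]
    -- The Maxwell half of the system is automatic for this Φ₂, so only the Einstein half constrains
    -- H.
    exact ⟨fun h => h.einstein, fun h => ⟨(isMaxwellField_iff_exists hI hΩ hP hH
      (contDiffOn_nullComponent hP hE)).2 ⟨E₂, hE, fun x _ => rfl⟩, h⟩⟩
  · have hc := contDiffOn_chartH hH
    refine ⟨isNullTetrad_naturalTetrad (hp x hx), psi0_naturalTetrad hR hp hc hx,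
      psi1_naturalTetrad hR hp hc hx, psi2_naturalTetrad hR hp hc hx,
      psi3_naturalTetrad hR hp hc hx, ?_, isPetrovTypeII_of_psi4_ne_zero hΛ hR hp hc hx⟩
    have hp' : (nariaiP Λ (zCoord x) : ℂ) ≠ 0 := by exact_mod_cast hP _ hx.2
    rw [psi4_eq_dzeta_dzeta hI hΩ hP hH hx, show nariaiQ Λ (zCoord x) = nariaiP Λ (zCoord x) from rfl]
    field_simp
  · intro W
    have hc := contDiffOn_chartH hH
    obtain ⟨E, hE, hΦE⟩ := (isMaxwellField_iff_exists hI hΩ hP hH hΦ).1 hEM.maxwell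
    obtain ⟨A, hA⟩ := exists_isZetaPrimitive hI hΩ hΩc hE
    obtain ⟨f, hf, hHf⟩ := (laplacian_profile_iff hI hΩ hΩc hE hA hH).1
      ((einstein_iff_laplacian hI hΩ hP hH hΦE).1 hEM.einstein)
    have hEne : ∃ ζ ∈ Ω, E u ζ ≠ 0 := by
      obtain ⟨v, ζ, hζ, hne⟩ := hne
      refine ⟨ζ, hζ, fun h => hne ?_⟩
      have hx := pt_mem_region hu hζ v
      rw [hΦE _ hx, nullComponent_eq (hp _ hx), uCoord_pt, zCoord_pt, h, zero_mul]
    -- Ψ₄ = ½ P (PH)_ζζ is independent of v and its nonvanishing implies type II, so both conditions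
    -- for all v reduce to one condition on ζ.
    have hW : W = {ζ ∈ Ω | dzeta (dzeta fun ζ => (nariaiP Λ ζ : ℂ) * (H u ζ : ℂ)) ζ ≠ 0} := by
      ext ζ
      refine and_congr_right fun hζ => ?_
      have hψ (v : ℝ) := psi4_eq_dzeta_dzeta hI hΩ hP hH (pt_mem_region hu hζ v)
      simp only [uCoord_pt, zCoord_pt] at hψ
      have hpζ : (nariaiP Λ ζ : ℂ) ≠ 0 := by exact_mod_cast hP ζ hζ
      refine ⟨fun h h0 => (h 0).1 (by rw [hψ, h0, mul_zero, zero_mul]), fun h v => ?_⟩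
      have h4 : Psi4 (nariaiWave Λ H) (pt u v ζ) (naturalTetrad Λ H (pt u v ζ)) ≠ 0 := by
        rw [hψ]
        exact mul_ne_zero (mul_ne_zero (by norm_num) h) hpζ
      exact ⟨h4, isPetrovTypeII_of_psi4_ne_zero hΛ hR hp hc (pt_mem_region hu hζ v) h4⟩
    rw [hW]
    exact isOpen_and_dense_gravitational_wave hΛ hI hΩ hΩc hH hE hA hf hu
      (fun ζ hζ => hHf u hu ζ hζ) hEne
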